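/- Let $X=\partial_x$ and $Y=\partial_y+x\,\partial_w$ on $\mathbb R^3$ with coordinates $(x,y,w)$, let $n\ge 2$, and let $L=P(X,Y)=\sum_{l=0}^n P_l(X,Y)$, where each $P_l$ is a homogeneous polynomial of degree $l$ in two non-commuting variables with complex coefficients. Assume that $P_n$ is generic: for complex $z$, $P_n(iz,0)=z^n$, and $P_n(iz,1)$ has $n$ distinct complex roots. For $\gamma>0$ define the ordinary differential operators in the variable $t\in\mathbb R$ $$\mathcal L_\gamma^{\pm}=\sum_{l=0}^n\Big(\frac{i}{\gamma}\Big)^{n-l}P_l(i\partial_t,\pm t).$$ A family $\mathcal L_\gamma$ of such operators is said to have a regular parametrix on $\Omega=\mathbb R\times(\gamma_0,\infty)$, where $\gamma_0>0$, if for every $g\in C^\infty(\mathbb R)$ (complex-valued) that is bounded together with each of its derivatives there is a function $F(t,\gamma)$ such that: (1) $F$ is smooth in $(t,\gamma)\in\Omega$; (2) $\mathcal L_\gamma F(\cdot,\gamma)=g$ for every $\gamma>\gamma_0$; (3) for every $m$ there are $a,C>0$ with $|\partial_t^jF(t,\gamma)|\le C(1+|t|+|\gamma|)^a$ on $\Omega$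 for all $0\le j\le m$. If, for some $\gamma_0>0$, both $\mathcal L_\gamma^+$ and $\mathcal L_\gamma^-$ have regular parametrices on $\mathbb R\times(\gamma_0,\infty)$, then $L$ is locally solvable: every point of $\mathbb R^3$ has an open neighbourhood $U$ such that for every $f\in C_c^\infty(U)$ there is a distribution $u$ on $U$ with $Lu=f$ on $U$. -/

import Mathlib

open scoped ContDiff Distributions LineDeriv

noncomputable section

namespace HeisenbergSolvability

/-! ### Polynomials in two non-commuting variables -/

/-- Polynomials with complex coefficients in two non-commuting variables. -/
abbrev NCPoly : Type := FreeAlgebra ℂ (Fin 2)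

/-- The value `P(A, B)` in an arbitrary (possibly non-commutative) complex algebra. -/
def NCPoly.eval {R : Type*} [Ring R] [Algebra ℂ R] (A B : R) (P : NCPoly) : R :=
  FreeAlgebra.lift ℂ ![A, B] P

/-- `P` is homogeneous of degree `l`: a linear combination of words of length `l`. -/
def NCPoly.IsHomogeneous (l : ℕ) (P : NCPoly) : Prop :=
  P ∈ Submodule.span ℂ (Set.range (FreeAlgebra.ι ℂ : Fin 2 → NCPoly)) ^ l

/-- `P` is generic of degree `n`: `P(iz, 0) = zⁿ` for all complex `z`, and `P(iz, 1)` has `n`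
distinct complex roots. -/
def NCPoly.IsGeneric (n : ℕ) (P : NCPoly) : Prop :=
  (∀ z : ℂ, NCPoly.eval (Complex.I * z) 0 P = z ^ n) ∧
    {z : ℂ | NCPoly.eval (Complex.I * z) 1 P = 0}.ncard = n

/-! ### The left-invariant operators on distributions, and local solvability -/

/-- The underlying space of the Heisenberg group, with coordinates `(x, y, w)`. -/
abbrev H1 : Type := ℝ × ℝ × ℝ

/-- Multiplication of real test functions on `U` by the coordinate function `x`. -/
def testMulX (U : TopologicalSpace.Opens H1) : 𝓓(U, ℝ) →L[ℝ] 𝓓(U, ℝ) :=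
  TestFunction.limitCLM ℝ
    (fun φ => ⟨fun p => φ p * p.1, φ.contDiff.mul contDiff_fst, φ.hasCompactSupport.mul_right,
      (tsupport_mul_subset_left (f := φ) (g := fun p : H1 => p.1)).trans φ.tsupport_subset⟩)
    (fun _ hK => (TestFunction.ofSupportedInCLM ℝ hK).comp
      (ContDiffMapSupportedIn.bilinLeftCLM (ContinuousLinearMap.mul ℝ ℝ)
        (g := fun p : H1 => p.1) contDiff_fst))
    (fun _ _ _ => rfl)

/-- Multiplication of complex distributions on `U` by the coordinate function `x`. -/
def distMulX (U : TopologicalSpace.Opens H1) : Module.End ℂ 𝓓'(U, ℂ) where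
  toFun u := (testMulX U).precompCompactConvergenceCLM ℂ u
  map_add' _ _ := map_add _ _ _
  map_smul' _ _ := rfl

/-- The derivative along the constant vector `v`, on complex distributions on `U`. -/
def distDeriv (U : TopologicalSpace.Opens H1) (v : H1) : Module.End ℂ 𝓓'(U, ℂ) where
  toFun u := ∂_{v} u
  map_add' u u' := LineDeriv.lineDerivOp_add v u u'
  map_smul' c u := by
    ext φ
    simp

/-- `X = ∂_x`, acting on complex distributions on `U`. -/
def opX (U : TopologicalSpace.Opens H1) : Module.End ℂ 𝓓'(U, ℂ) := distDeriv U (1, 0, 0)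

/-- `Y = ∂_y + x ∂_w`, acting on complex distributions on `U`. -/
def opY (U : TopologicalSpace.Opens H1) : Module.End ℂ 𝓓'(U, ℂ) :=
  distDeriv U (0, 1, 0) + distMulX U * distDeriv U (0, 0, 1)

/-- Local solvability of `P(X, Y)`: every point has an open neighbourhood `U` such that for every
`f ∈ C_c^∞(U)` there is a distribution `u` on `U` with `P(X, Y) u = f` on `U`. -/
def LocallySolvable (P : NCPoly) : Prop :=
  ∀ p : H1, ∃ U : TopologicalSpace.Opens H1, p ∈ U ∧
    ∀ f : 𝓓(U, ℂ), ∃ u : 𝓓'(U, ℂ),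
      ∀ φ : 𝓓(U, ℝ), (NCPoly.eval (opX U) (opY U) P u) φ = ∫ q, φ q • f q

/-! ### The realizations as ordinary differential operators, and regular parametrices -/

/-- The space of smooth functions `ℝ → ℂ`. -/
def SmoothFun : Submodule ℂ (ℝ → ℂ) where
  carrier := {f | ContDiff ℝ ∞ f}
  add_mem' {f g} (hf : ContDiff ℝ ∞ f) (hg : ContDiff ℝ ∞ g) := hf.add hg
  zero_mem' := (contDiff_const : ContDiff ℝ ∞ fun _ : ℝ => (0 : ℂ))
  smul_mem' c f (hf : ContDiff ℝ ∞ f) := hf.const_smul c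

/-- `∂_t` on smooth functions. -/
def opD : Module.End ℂ SmoothFun where
  toFun f := ⟨deriv f.1, (contDiff_infty_iff_deriv.1 f.2).2⟩
  map_add' f g := by
    ext t
    exact deriv_add ((contDiff_infty_iff_deriv.1 f.2).1 t) ((contDiff_infty_iff_deriv.1 g.2).1 t)
  map_smul' c f := by
    ext t
    exact deriv_const_smul c ((contDiff_infty_iff_deriv.1 f.2).1 t)

/-- Multiplication by the variable `t` on smooth functions. -/
def opT : Module.End ℂ SmoothFun where
  toFun f := ⟨fun t => (t : ℂ) * f.1 t, Complex.ofRealCLM.contDiff.mul (show ContDiff ℝ ∞ f.1 from f.2)⟩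
  map_add' f g := by
    ext t
    exact mul_add _ _ _
  map_smul' c f := by
    ext t
    exact mul_left_comm _ _ _

/-- The realization `∑_{l ≤ n} (i/γ)^(n-l) P_l(i ∂_t, σ t)`, with sign `σ = 1` or `σ = -1`. -/
def realization (n : ℕ) (P : ℕ → NCPoly) (σ : ℂ) (γ : ℝ) : Module.End ℂ SmoothFun :=
  ∑ l ∈ Finset.range (n + 1),
    (Complex.I / (γ : ℂ)) ^ (n - l) • NCPoly.eval (Complex.I • opD) (σ • opT) (P l)

/-- The family `𝓛 γ` has a regular parametrix on `ℝ × (γ₀, ∞)`: for every smooth `g` bounded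
together with each of its derivatives there is `F(t, γ)`, smooth on `ℝ × (γ₀, ∞)`, with
`𝓛 γ F(·, γ) = g` there and with each `t`-derivative polynomially bounded there.
(The values `F γ` for `γ ≤ γ₀` are irrelevant.) -/
def HasRegularParametrix (𝓛 : ℝ → Module.End ℂ SmoothFun) (γ₀ : ℝ) : Prop :=
  ∀ g : SmoothFun, (∀ j : ℕ, ∃ B : ℝ, ∀ t : ℝ, ‖iteratedDeriv j g.1 t‖ ≤ B) →
    ∃ F : ℝ → SmoothFun,
      ContDiffOn ℝ ∞ (fun q : ℝ × ℝ => (F q.2).1 q.1) (Set.univ ×ˢ Set.Ioi γ₀) ∧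
      (∀ γ, γ₀ < γ → 𝓛 γ (F γ) = g) ∧
      ∀ m : ℕ, ∃ a C : ℝ, 0 < a ∧ 0 < C ∧ ∀ j ≤ m, ∀ t γ : ℝ, γ₀ < γ →
        ‖iteratedDeriv j (F γ).1 t‖ ≤ C * (1 + |t| + |γ|) ^ a

end HeisenbergSolvability

end

open HeisenbergSolvability

/-!
The operator `P(X, Y)` is separated by waves `F(γ x + σ η / γ) exp(i (η y + σ γ² w))` with
`σ = ±1`: on them `X` acts as `γ ∂_t` and `Y` as `i σ γ t` on the profile `F`, so `P(X, Y)` acts as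
`(-iγ)ⁿ` times the realization of sign `-σ` (`eval_sum_waveLift`). Integrating a parametrix by
parts against a test function `φ` therefore bounds the pairing of `φ` with the wave of `g` by a
weighted `L¹` norm of the formal transpose applied to `φ`, with constant and order of growth
depending on `g`.

This dependence is removed by a uniform boundedness argument (`exists_uniform_bound_expFun`): on the
exponentials `g(t) = exp(i κ t)` one order suffices, and the constants grow polynomially in `κ`. The
waves of exponentials are the characters of `ℝ³`, so the Fourier transform of `φ` is bounded
polynomially by the `L¹` norm of the transpose of `P(X, Y)` applied to `φ`, at all frequencies `μ`
in `w` with `|μ| > γ₀²` (`exists_bound_character`).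

Low frequencies in `w` never have to be solved for. If `f` is supported in a ball of radius
`1 / (2 γ₀²)`, adding to it multiples of its translates by `k / γ₀²` in `w`, `k ≠ 0`, does not
change it on the ball, and a suitable choice of the coefficients multiplies its Fourier transform
by a periodic function that vanishes for `|μ| ≤ γ₀²` (`exists_const_mul_eq_integral`). Fourier
inversion then gives `|∫ f φ| ≤ C ‖ᵗP(X, Y) φ‖_{L¹}` for test functions `φ` on the ball
(`exists_bound_integral_mul`), and the Hahn–Banach theorem produces the distribution `u`.
-/

noncomputable section

namespace HeisenbergSolvability

open MeasureTheory MulOpposite FourierTransform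
open scoped SchwartzMap

/-! ### Evaluation of non-commutative polynomials -/

theorem NCPoly.eval_algebraMap {R : Type*} [Ring R] [Algebra ℂ R] (A B : R) (c : ℂ) :
    NCPoly.eval A B (algebraMap ℂ NCPoly c) = algebraMap ℂ R c :=
  AlgHom.commutes _ _

theorem NCPoly.eval_mul {R : Type*} [Ring R] [Algebra ℂ R] (A B : R) (P Q : NCPoly) :
    NCPoly.eval A B (P * Q) = NCPoly.eval A B P * NCPoly.eval A B Q :=
  map_mul _ _ _

theorem NCPoly.eval_add {R : Type*} [Ring R] [Algebra ℂ R] (A B : R) (P Q : NCPoly) :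
    NCPoly.eval A B (P + Q) = NCPoly.eval A B P + NCPoly.eval A B Q :=
  map_add _ _ _

theorem NCPoly.eval_sum {R : Type*} [Ring R] [Algebra ℂ R] (A B : R) {ι : Type*}
    (s : Finset ι) (P : ι → NCPoly) :
    NCPoly.eval A B (∑ l ∈ s, P l) = ∑ l ∈ s, NCPoly.eval A B (P l) :=
  map_sum _ _ _

theorem NCPoly.eval_ι_zero {R : Type*} [Ring R] [Algebra ℂ R] (A B : R) :
    NCPoly.eval A B (FreeAlgebra.ι ℂ 0) = A := by
  simp [NCPoly.eval]

theorem NCPoly.eval_ι_one {R : Type*} [Ring R] [Algebra ℂ R] (A B : R) :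
    NCPoly.eval A B (FreeAlgebra.ι ℂ 1) = B := by
  simp [NCPoly.eval]

theorem NCPoly.IsHomogeneous.eval_smul_smul {R : Type*} [Ring R] [Algebra ℂ R] (A B : R) (c : ℂ)
    {l : ℕ} {P : NCPoly} (hP : P.IsHomogeneous l) :
    NCPoly.eval (c • A) (c • B) P = c ^ l • NCPoly.eval A B P := by
  unfold NCPoly.IsHomogeneous at hP
  induction hP using Submodule.pow_induction_on_left' with
  | algebraMap r => simp [NCPoly.eval_algebraMap]
  | add x y i hx hy ihx ihy => rw [NCPoly.eval_add, NCPoly.eval_add, ihx, ihy, smul_add]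
  | mem_mul m hm i x hx ih =>
    suffices h : NCPoly.eval (c • A) (c • B) m = c • NCPoly.eval A B m by
      rw [NCPoly.eval_mul, NCPoly.eval_mul, ih, h, smul_mul_smul_comm, pow_succ']
    clear ih hx
    induction hm using Submodule.span_induction with
    | mem x hx =>
      obtain ⟨j, rfl⟩ := hx
      fin_cases j
      · simp [NCPoly.eval_ι_zero]
      · simp [NCPoly.eval_ι_one]
    | zero => simp [NCPoly.eval]
    | add x y _ _ hx hy =>
      simp only [NCPoly.eval_add, smul_add, hx, hy]
    | smul a x _ hx =>
      simp only [NCPoly.eval, map_smul] at hx ⊢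
      rw [hx, smul_comm]

/-! ### The fields on smooth functions, and their formal transposes -/

/-- The space of smooth functions `H1 → ℂ`. -/
def SmoothH1 : Submodule ℂ (H1 → ℂ) where
  carrier := {f | ContDiff ℝ ∞ f}
  add_mem' {f g} (hf : ContDiff ℝ ∞ f) (hg : ContDiff ℝ ∞ g) := hf.add hg
  zero_mem' := (contDiff_const : ContDiff ℝ ∞ fun _ : H1 => (0 : ℂ))
  smul_mem' c f (hf : ContDiff ℝ ∞ f) := hf.const_smul c

theorem smoothH1_contDiff (f : SmoothH1) : ContDiff ℝ ∞ f.1 := f.2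

theorem smoothH1_differentiable (f : SmoothH1) : Differentiable ℝ f.1 :=
  (smoothH1_contDiff f).differentiable (by simp)

theorem smoothH1_continuous (f : SmoothH1) : Continuous f.1 := (smoothH1_contDiff f).continuous

/-- The derivative along the constant vector `v`, on smooth functions. -/
def smoothDeriv (v : H1) : Module.End ℂ SmoothH1 where
  toFun f := ⟨fun p => fderiv ℝ f.1 p v,
    ((smoothH1_contDiff f).fderiv_right (m := ∞) (by simp)).clm_apply contDiff_const⟩
  map_add' f g := by
    ext p
    simp [fderiv_add (smoothH1_differentiable f p) (smoothH1_differentiable g p)]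
  map_smul' c f := by
    ext p
    simp [fderiv_const_smul (smoothH1_differentiable f p)]

/-- Multiplication by the coordinate function `x`, on smooth functions. -/
def smoothMulX : Module.End ℂ SmoothH1 where
  toFun f := ⟨fun p => (p.1 : ℂ) * f.1 p,
    (Complex.ofRealCLM.contDiff.comp contDiff_fst).mul (smoothH1_contDiff f)⟩
  map_add' f g := by
    ext p
    exact mul_add _ _ _
  map_smul' c f := by
    ext p
    exact mul_left_comm _ _ _

/-- `X = ∂_x`, acting on smooth functions. -/
def fieldX : Module.End ℂ SmoothH1 := smoothDeriv (1, 0, 0)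

/-- `Y = ∂_y + x ∂_w`, acting on smooth functions. -/
def fieldY : Module.End ℂ SmoothH1 := smoothDeriv (0, 1, 0) + smoothMulX * smoothDeriv (0, 0, 1)

/-- The formal transpose of `P(X, Y)`: since `X` and `Y` are formally skew, it is the value of `P`
at `-X`, `-Y` with the order of the factors reversed. -/
def formalTranspose (P : NCPoly) : Module.End ℂ SmoothH1 :=
  unop (NCPoly.eval (op (-fieldX)) (op (-fieldY)) P)

/-- Induction principle for the formal transpose: a relation between operators `P(A, B)` and
`formalTranspose P` that holds for scalars and for the two generators, and that is compatible with
sums and products, holds for all `P`. -/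
theorem formalTranspose_induction {R : Type*} [Ring R] [Algebra ℂ R] {A B : R}
    (r : R → Module.End ℂ SmoothH1 → Prop)
    (scalar : ∀ c : ℂ, r (algebraMap ℂ R c) (algebraMap ℂ _ c))
    (gen_X : r A (-fieldX)) (gen_Y : r B (-fieldY))
    (add : ∀ a b a' b', r a a' → r b b' → r (a + b) (a' + b'))
    (mul : ∀ a b a' b', r a a' → r b b' → r (a * b) (b' * a')) (P : NCPoly) :
    r (NCPoly.eval A B P) (formalTranspose P) := by
  unfold formalTranspose
  induction P using FreeAlgebra.induction with
  | grade0 c =>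
    simp only [NCPoly.eval_algebraMap, MulOpposite.algebraMap_apply, unop_op]
    exact scalar c
  | grade1 j =>
    fin_cases j
    · simpa [NCPoly.eval_ι_zero] using gen_X
    · simpa [NCPoly.eval_ι_one] using gen_Y
  | mul P Q hP hQ =>
    rw [NCPoly.eval_mul, NCPoly.eval_mul, unop_mul]
    exact mul _ _ _ _ hP hQ
  | add P Q hP hQ =>
    rw [NCPoly.eval_add, NCPoly.eval_add, unop_add]
    exact add _ _ _ _ hP hQ

/-- `B` is a transpose of `A` with respect to integration, and does not increase supports. -/
def IsTranspose (A B : Module.End ℂ SmoothH1) : Prop :=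
  ∀ φ : SmoothH1, HasCompactSupport φ.1 → tsupport (B φ).1 ⊆ tsupport φ.1 ∧
    ∀ u : SmoothH1, ∫ q, (A u).1 q * φ.1 q = ∫ q, u.1 q * (B φ).1 q

theorem smoothH1_integrable_mul (u φ : SmoothH1) (hφ : HasCompactSupport φ.1) :
    Integrable (fun q => u.1 q * φ.1 q) :=
  ((smoothH1_continuous u).mul (smoothH1_continuous φ)).integrable_of_hasCompactSupport hφ.mul_left

theorem IsTranspose.hasCompactSupport {A B : Module.End ℂ SmoothH1} (h : IsTranspose A B)
    {φ : SmoothH1} (hφ : HasCompactSupport φ.1) : HasCompactSupport (B φ).1 :=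
  hφ.of_isClosed_subset (isClosed_tsupport _) (h φ hφ).1

theorem IsTranspose.add {A B A' B' : Module.End ℂ SmoothH1} (h : IsTranspose A B)
    (h' : IsTranspose A' B') : IsTranspose (A + A') (B + B') := by
  intro φ hφ
  refine ⟨(tsupport_add _ _).trans (Set.union_subset (h φ hφ).1 (h' φ hφ).1), fun u => ?_⟩
  have h₁ := integral_add (smoothH1_integrable_mul (A u) φ hφ) (smoothH1_integrable_mul (A' u) φ hφ)
  have h₂ := integral_add (smoothH1_integrable_mul u (B φ) (h.hasCompactSupport hφ))
    (smoothH1_integrable_mul u (B' φ) (h'.hasCompactSupport hφ))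
  rw [(h φ hφ).2 u, (h' φ hφ).2 u, ← h₂] at h₁
  simpa [add_mul, mul_add] using h₁

theorem IsTranspose.mul {A B A' B' : Module.End ℂ SmoothH1} (h : IsTranspose A B)
    (h' : IsTranspose A' B') : IsTranspose (A * A') (B' * B) := by
  intro φ hφ
  have hc := h.hasCompactSupport hφ
  refine ⟨((h' _ hc).1).trans (h φ hφ).1, fun u => ?_⟩
  exact ((h φ hφ).2 (A' u)).trans ((h' _ hc).2 u)

theorem isTranspose_algebraMap (c : ℂ) :
    IsTranspose (algebraMap ℂ _ c) (algebraMap ℂ _ c) := by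
  intro φ _
  refine ⟨tsupport_smul_subset_right (fun _ => c) φ.1, fun u => ?_⟩
  simp [mul_left_comm, mul_assoc]

theorem isTranspose_smoothMulX : IsTranspose smoothMulX smoothMulX := by
  intro φ _
  refine ⟨tsupport_mul_subset_right (f := fun p : H1 => (p.1 : ℂ)) (g := φ.1), fun u => ?_⟩
  simp [smoothMulX, mul_left_comm, mul_assoc]

instance isAddHaarMeasure_volume_H1 : (volume : Measure H1).IsAddHaarMeasure :=
  have : (volume : Measure (ℝ × ℝ)).IsAddHaarMeasure :=
    Measure.prod.instIsAddHaarMeasure (volume : Measure ℝ) (volume : Measure ℝ)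
  Measure.prod.instIsAddHaarMeasure (volume : Measure ℝ) (volume : Measure (ℝ × ℝ))

theorem isTranspose_smoothDeriv (v : H1) : IsTranspose (smoothDeriv v) (-smoothDeriv v) := by
  intro φ hφ
  have hs : tsupport (smoothDeriv v φ).1 ⊆ tsupport φ.1 := tsupport_fderiv_apply_subset ℝ v
  refine ⟨(tsupport_neg _).trans_subset hs, fun u => ?_⟩
  have h := integral_mul_fderiv_eq_neg_fderiv_mul_of_integrable (μ := (volume : Measure H1))
    (f := u.1) (g := φ.1) (v := v) (smoothH1_integrable_mul (smoothDeriv v u) φ hφ)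
    (smoothH1_integrable_mul u (smoothDeriv v φ) (hφ.of_isClosed_subset (isClosed_tsupport _) hs))
    (smoothH1_integrable_mul u φ hφ) (fun x _ => smoothH1_differentiable u x)
    (fun x _ => smoothH1_differentiable φ x)
  simpa [smoothDeriv, integral_neg] using (neg_eq_iff_eq_neg.2 h).symm

/-- `x` and `∂_w` commute, which is why `Y` is formally skew. -/
theorem smoothDeriv_mul_smoothMulX :
    smoothDeriv (0, 0, 1) * smoothMulX = smoothMulX * smoothDeriv (0, 0, 1) := by
  ext φ p
  have h : HasFDerivAt (fun p : H1 => (p.1 : ℂ))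
      (Complex.ofRealCLM ∘L ContinuousLinearMap.fst ℝ ℝ (ℝ × ℝ)) p :=
    Complex.ofRealCLM.hasFDerivAt.comp p hasFDerivAt_fst
  have h' := (h.mul (smoothH1_differentiable φ p).hasFDerivAt).fderiv
  simp only [smoothDeriv, smoothMulX, Module.End.mul_apply, LinearMap.coe_mk, AddHom.coe_mk]
  change fderiv ℝ ((fun p : H1 => (p.1 : ℂ)) * φ.1) p (0, 0, 1) = _
  rw [h']
  simp

theorem isTranspose_fieldX : IsTranspose fieldX (-fieldX) := isTranspose_smoothDeriv _

theorem isTranspose_fieldY : IsTranspose fieldY (-fieldY) := by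
  have h := (isTranspose_smoothDeriv (0, 1, 0)).add
    (isTranspose_smoothMulX.mul (isTranspose_smoothDeriv (0, 0, 1)))
  have e : -smoothDeriv (0, 1, 0) + -smoothDeriv (0, 0, 1) * smoothMulX = -fieldY := by
    rw [fieldY, ← smoothDeriv_mul_smoothMulX]
    exact LinearMap.ext fun φ => (neg_add _ _).symm
  rwa [e] at h

theorem isTranspose_formalTranspose (P : NCPoly) :
    IsTranspose (NCPoly.eval fieldX fieldY P) (formalTranspose P) := by
  refine formalTranspose_induction IsTranspose ?_ ?_ ?_ ?_ ?_ P
  · exact isTranspose_algebraMap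
  · exact isTranspose_fieldX
  · exact isTranspose_fieldY
  · exact fun _ _ _ _ h h' => h.add h'
  · exact fun _ _ _ _ h h' => h.mul h'

/-! ### Distributions induced by linear functionals on smooth functions -/

/-- A real test function, as a smooth complex function on the whole space. -/
def testToSmooth {U : TopologicalSpace.Opens H1} (ψ : 𝓓(U, ℝ)) : SmoothH1 :=
  ⟨fun q => (ψ q : ℂ), Complex.ofRealCLM.contDiff.comp ψ.contDiff⟩

theorem testToSmooth_lineDeriv {U : TopologicalSpace.Opens H1} (v : H1) (ψ : 𝓓(U, ℝ)) :
    testToSmooth (∂_{v} ψ) = smoothDeriv v (testToSmooth ψ) := by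
  ext p
  have hd : DifferentiableAt ℝ ψ p := ψ.contDiff.differentiable (by simp) p
  have h := (Complex.ofRealCLM.hasFDerivAt.comp p hd.hasFDerivAt).fderiv
  have h₁ : (∂_{v} ψ : 𝓓(U, ℝ)) p = fderiv ℝ ψ p v := by
    rw [TestFunction.lineDerivOp_eq_lineDerivCLM ℝ, TestFunction.lineDerivCLM_apply_of_le le_top,
      hd.lineDeriv_eq_fderiv]
  change (((∂_{v} ψ : 𝓓(U, ℝ)) p : ℝ) : ℂ) = fderiv ℝ (Complex.ofRealCLM ∘ ψ) p v
  rw [h, h₁]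
  rfl

theorem testToSmooth_testMulX {U : TopologicalSpace.Opens H1} (ψ : 𝓓(U, ℝ)) :
    testToSmooth (testMulX U ψ) = smoothMulX (testToSmooth ψ) := by
  ext p
  change ((ψ p * p.1 : ℝ) : ℂ) = (p.1 : ℂ) * (ψ p : ℂ)
  push_cast
  ring

theorem testToSmooth_neg {U : TopologicalSpace.Opens H1} (ψ : 𝓓(U, ℝ)) :
    testToSmooth (-ψ) = -testToSmooth ψ := by
  ext p
  simp [testToSmooth]

theorem distDeriv_apply_eq {U : TopologicalSpace.Opens H1} (v : H1) {u : 𝓓'(U, ℂ)}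
    {T : SmoothH1 →ₗ[ℂ] ℂ} (h : ∀ ψ, u ψ = T (testToSmooth ψ)) (ψ : 𝓓(U, ℝ)) :
    distDeriv U v u ψ = (-(T ∘ₗ smoothDeriv v)) (testToSmooth ψ) := by
  change (∂_{v} u) ψ = _
  rw [Distribution.lineDerivOp_apply_apply, h, testToSmooth_neg, testToSmooth_lineDeriv]
  simp

theorem distMulX_apply_eq {U : TopologicalSpace.Opens H1} {u : 𝓓'(U, ℂ)}
    {T : SmoothH1 →ₗ[ℂ] ℂ} (h : ∀ ψ, u ψ = T (testToSmooth ψ)) (ψ : 𝓓(U, ℝ)) :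
    distMulX U u ψ = (T ∘ₗ smoothMulX) (testToSmooth ψ) := by
  change u (testMulX U ψ) = _
  rw [h, testToSmooth_testMulX]
  rfl

/-- If a distribution is the restriction of a linear functional `T` on all smooth functions, then
`P(X, Y)` acts on it by composing `T` with the formal transpose. -/
theorem eval_opX_opY_apply_eq {U : TopologicalSpace.Opens H1} (P : NCPoly) {u : 𝓓'(U, ℂ)}
    {T : SmoothH1 →ₗ[ℂ] ℂ} (h : ∀ ψ, u ψ = T (testToSmooth ψ)) (ψ : 𝓓(U, ℝ)) :
    (NCPoly.eval (opX U) (opY U) P u) ψ = T (formalTranspose P (testToSmooth ψ)) := by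
  refine formalTranspose_induction (A := opX U) (B := opY U)
    (fun a a' => ∀ (u : 𝓓'(U, ℂ)) (T : SmoothH1 →ₗ[ℂ] ℂ), (∀ ψ, u ψ = T (testToSmooth ψ)) →
      ∀ ψ, a u ψ = T (a' (testToSmooth ψ))) ?_ ?_ ?_ ?_ ?_ P u T h ψ
  · intro c u T h ψ
    change c • u ψ = _
    simp [h]
  · intro u T h ψ
    rw [opX, distDeriv_apply_eq _ h]
    simp [fieldX]
  · intro u T h ψ
    change distDeriv U (0, 1, 0) u ψ + distMulX U (distDeriv U (0, 0, 1) u) ψ = _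
    rw [distDeriv_apply_eq _ h, distMulX_apply_eq (distDeriv_apply_eq _ h)]
    have hc := LinearMap.congr_fun smoothDeriv_mul_smoothMulX (testToSmooth ψ)
    simp only [Module.End.mul_apply] at hc
    simp [fieldY, hc, add_comm]
  · intro a b a' b' ha hb u T h ψ
    change a u ψ + b u ψ = _
    rw [ha u T h, hb u T h]
    simp
  · intro a b a' b' ha hb u T h ψ
    exact ha (b u) (T ∘ₗ b') (hb u T h) ψ

/-! ### Separation of variables -/

/-- The phase `i (η y + σ γ² w)`. -/
def wavePhase (σ γ η : ℝ) (p : H1) : ℂ :=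
  Complex.I * ((η * p.2.1 + σ * γ ^ 2 * p.2.2 : ℝ) : ℂ)

/-- The function `F(γ x + σ η / γ) exp(i (η y + σ γ² w))` on `H1` obtained from a function `F` of
one variable. The argument of `F` is chosen so that `Y` acts as a multiple of `t`. -/
def waveLift (σ γ η : ℝ) : SmoothFun →ₗ[ℂ] SmoothH1 where
  toFun F := ⟨fun p => F.1 (γ * p.1 + σ * η / γ) * Complex.exp (wavePhase σ γ η p), by
    have hF : ContDiff ℝ ∞ F.1 := F.2
    have h₁ : ContDiff ℝ ∞ fun p : H1 => γ * p.1 + σ * η / γ := by fun_prop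
    have h₂ : ContDiff ℝ ∞ fun p : H1 => η * p.2.1 + σ * γ ^ 2 * p.2.2 := by fun_prop
    exact (hF.comp h₁).mul (Complex.contDiff_exp.comp
      (contDiff_const.mul (Complex.ofRealCLM.contDiff.comp h₂)))⟩
  map_add' F G := by
    ext p
    exact add_mul _ _ _
  map_smul' c F := by
    ext p
    exact mul_assoc _ _ _

theorem norm_waveLift (σ γ η : ℝ) (F : SmoothFun) (q : H1) :
    ‖(waveLift σ γ η F).1 q‖ = ‖F.1 (γ * q.1 + σ * η / γ)‖ := by
  have : ‖Complex.exp (wavePhase σ γ η q)‖ = 1 := by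
    rw [wavePhase, mul_comm, Complex.norm_exp_ofReal_mul_I]
  simp [waveLift, this]

theorem smoothDeriv_waveLift (σ γ η : ℝ) (v : H1) (F : SmoothFun) (p : H1) :
    (smoothDeriv v (waveLift σ γ η F)).1 p =
      γ * v.1 * (waveLift σ γ η (opD F)).1 p +
        Complex.I * (η * v.2.1 + σ * γ ^ 2 * v.2.2) * (waveLift σ γ η F).1 p := by
  have hF : HasDerivAt F.1 (deriv F.1 (γ * p.1 + σ * η / γ)) (γ * p.1 + σ * η / γ) :=
    ((contDiff_infty_iff_deriv.1 F.2).1 _).hasDerivAt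
  have h₁ : HasDerivAt (fun s : ℝ => γ * (p.1 + s * v.1) + σ * η / γ) (γ * v.1) 0 := by
    simpa using ((((hasDerivAt_id (0 : ℝ)).mul_const v.1).const_add p.1).const_mul γ).add_const
      (σ * η / γ)
  have h₂ : HasDerivAt (fun s : ℝ => wavePhase σ γ η (p + s • v))
      (Complex.I * (η * v.2.1 + σ * γ ^ 2 * v.2.2 : ℝ)) 0 := by
    have : HasDerivAt (fun s : ℝ => η * (p.2.1 + s * v.2.1) + σ * γ ^ 2 * (p.2.2 + s * v.2.2))
        (η * v.2.1 + σ * γ ^ 2 * v.2.2) 0 := by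
      simpa using ((((hasDerivAt_id (0 : ℝ)).mul_const v.2.1).const_add p.2.1).const_mul η).fun_add
        ((((hasDerivAt_id (0 : ℝ)).mul_const v.2.2).const_add p.2.2).const_mul (σ * γ ^ 2))
    exact this.ofReal_comp.const_mul Complex.I
  have hF' : HasDerivAt F.1 (deriv F.1 (γ * p.1 + σ * η / γ))
      (γ * (p.1 + 0 * v.1) + σ * η / γ) := by simpa using hF
  have h₃ := (hF'.scomp (0 : ℝ) h₁).mul h₂.cexp
  have h₄ : HasLineDerivAt ℝ (waveLift σ γ η F).1
      ((fderiv ℝ (waveLift σ γ η F).1 p) v) p v :=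
    (smoothH1_differentiable _ p).hasFDerivAt.hasLineDerivAt v
  have h₅ := HasDerivAt.unique h₄ h₃
  change fderiv ℝ (waveLift σ γ η F).1 p v = _
  rw [h₅]
  simp only [waveLift, opD, LinearMap.coe_mk, AddHom.coe_mk, Function.comp, zero_smul, add_zero,
    zero_mul, Complex.real_smul]
  push_cast
  ring

theorem fieldX_waveLift (σ γ η : ℝ) (F : SmoothFun) :
    fieldX (waveLift σ γ η F) = waveLift σ γ η (((γ : ℂ) • opD) F) := by
  ext p
  rw [fieldX, smoothDeriv_waveLift]
  simp

theorem fieldY_waveLift {σ γ : ℝ} (hσ : σ ^ 2 = 1) (hγ : γ ≠ 0) (η : ℝ) (F : SmoothFun) :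
    fieldY (waveLift σ γ η F) = waveLift σ γ η (((Complex.I * σ * γ) • opT) F) := by
  ext p
  have hσ' : (σ : ℂ) ^ 2 = 1 := by exact_mod_cast hσ
  have hγ' : (γ : ℂ) ≠ 0 := by exact_mod_cast hγ
  change (smoothDeriv (0, 1, 0) (waveLift σ γ η F)).1 p +
    p.1 * (smoothDeriv (0, 0, 1) (waveLift σ γ η F)).1 p = _
  rw [smoothDeriv_waveLift, smoothDeriv_waveLift]
  change γ * (0 : ℝ) * _ + Complex.I * (η * (1 : ℝ) + σ * γ ^ 2 * (0 : ℝ)) *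
      (F.1 (γ * p.1 + σ * η / γ) * Complex.exp (wavePhase σ γ η p)) +
    p.1 * (γ * (0 : ℝ) * _ + Complex.I * (η * (0 : ℝ) + σ * γ ^ 2 * (1 : ℝ)) *
      (F.1 (γ * p.1 + σ * η / γ) * Complex.exp (wavePhase σ γ η p))) =
    Complex.I * σ * γ * (((γ * p.1 + σ * η / γ : ℝ) : ℂ) * F.1 (γ * p.1 + σ * η / γ)) *
      Complex.exp (wavePhase σ γ η p)
  generalize F.1 (γ * p.1 + σ * η / γ) = z
  push_cast
  field_simp
  linear_combination (-(Complex.I * η * z * Complex.exp (wavePhase σ γ η p))) * hσ'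

theorem eval_waveLift {σ γ : ℝ} (hσ : σ ^ 2 = 1) (hγ : γ ≠ 0) (η : ℝ) (P : NCPoly)
    (F : SmoothFun) :
    NCPoly.eval fieldX fieldY P (waveLift σ γ η F) =
      waveLift σ γ η (NCPoly.eval ((γ : ℂ) • opD) ((Complex.I * σ * γ) • opT) P F) := by
  induction P using FreeAlgebra.induction generalizing F with
  | grade0 c =>
    simp only [NCPoly.eval_algebraMap, Module.algebraMap_end_apply, map_smul]
  | grade1 j =>
    fin_cases j
    · simpa only [Fin.zero_eta, NCPoly.eval_ι_zero] using fieldX_waveLift σ γ η F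
    · simpa only [Fin.mk_one, NCPoly.eval_ι_one] using fieldY_waveLift hσ hγ η F
  | mul P Q hP hQ =>
    rw [NCPoly.eval_mul, NCPoly.eval_mul, Module.End.mul_apply, Module.End.mul_apply, hQ, hP]
  | add P Q hP hQ =>
    rw [NCPoly.eval_add, NCPoly.eval_add, LinearMap.add_apply, LinearMap.add_apply, map_add,
      hP, hQ]

/-- On waves of frequency `σ γ²` in `w`, the operator `P(X, Y)` is, up to the factor `(-iγ)ⁿ`, the
realization with the opposite sign. -/
theorem eval_sum_waveLift {σ γ : ℝ} (hσ : σ ^ 2 = 1) (hγ : γ ≠ 0) (η : ℝ) {n : ℕ}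
    {P : ℕ → NCPoly} (hP : ∀ l ≤ n, (P l).IsHomogeneous l) (F : SmoothFun) :
    NCPoly.eval fieldX fieldY (∑ l ∈ Finset.range (n + 1), P l) (waveLift σ γ η F) =
      (-Complex.I * γ) ^ n • waveLift σ γ η (realization n P (-σ) γ F) := by
  have hγ' : (γ : ℂ) ≠ 0 := by exact_mod_cast hγ
  rw [eval_waveLift hσ hγ, NCPoly.eval_sum, realization, ← map_smul]
  congr 1
  simp only [LinearMap.sum_apply, Finset.smul_sum, LinearMap.smul_apply]
  refine Finset.sum_congr rfl fun l hl => ?_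
  have hln : l ≤ n := Nat.lt_succ_iff.1 (Finset.mem_range.1 hl)
  have hX : (γ : ℂ) • opD = (-Complex.I * γ) • (Complex.I • opD) := by
    rw [smul_smul]
    congr 1
    linear_combination (γ : ℂ) * Complex.I_mul_I
  have hY : (Complex.I * σ * γ) • opT = (-Complex.I * γ) • ((-(σ : ℂ)) • opT) := by
    rw [smul_smul]
    congr 1
    ring
  rw [hX, hY, (hP l hln).eval_smul_smul, LinearMap.smul_apply, smul_smul]
  congr 1
  obtain ⟨k, rfl⟩ := Nat.exists_eq_add_of_le hln
  have : -Complex.I * γ * (Complex.I / γ) = 1 := by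
    field_simp
    simp
  rw [pow_add, mul_assoc, Nat.add_sub_cancel_left, ← mul_pow, this, one_pow, mul_one]

/-- A solution of the ordinary differential equation turns an integral against the wave of `g`
into an integral against the formal transpose. -/
theorem norm_integral_waveLift_le {σ γ : ℝ} (hσ : σ ^ 2 = 1) (hγ : 0 < γ) (η : ℝ) {n : ℕ}
    {P : ℕ → NCPoly} (hP : ∀ l ≤ n, (P l).IsHomogeneous l) {F g : SmoothFun}
    (hF : realization n P (-σ) γ F = g) {W : ℝ → ℝ} (hW : Continuous W)
    (hFW : ∀ t, ‖F.1 t‖ ≤ W t) {φ : SmoothH1} (hφ : HasCompactSupport φ.1) :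
    ‖∫ q, (waveLift σ γ η g).1 q * φ.1 q‖ ≤ (γ ^ n)⁻¹ *
      ∫ q : H1, W (γ * q.1 + σ * η / γ) *
        ‖(formalTranspose (∑ l ∈ Finset.range (n + 1), P l) φ).1 q‖ := by
  set Q := ∑ l ∈ Finset.range (n + 1), P l
  have hT := isTranspose_formalTranspose Q
  have h := (hT φ hφ).2 (waveLift σ γ η F)
  have hc := hT.hasCompactSupport hφ
  rw [eval_sum_waveLift hσ hγ.ne' η hP, hF] at h
  have h' : (-Complex.I * γ) ^ n * ∫ q, (waveLift σ γ η g).1 q * φ.1 q =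
      ∫ q, (waveLift σ γ η F).1 q * (formalTranspose Q φ).1 q := by
    rw [← h, ← integral_const_mul]
    simp [mul_assoc]
  have hn := congrArg norm h'
  rw [norm_mul, norm_pow, norm_mul, norm_neg, Complex.norm_I, one_mul, Complex.norm_real,
    Real.norm_of_nonneg hγ.le] at hn
  rw [le_inv_mul_iff₀ (pow_pos hγ n), hn]
  refine norm_integral_le_of_norm_le ?_ (Filter.Eventually.of_forall fun q => ?_)
  · refine Continuous.integrable_of_hasCompactSupport ?_ hc.norm.mul_left
    exact (hW.comp (by fun_prop)).mul (smoothH1_continuous _).norm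
  · rw [norm_mul, norm_waveLift]
    gcongr
    exact hFW _

/-! ### Uniform boundedness on exponentials -/

/-- The exponential `t ↦ exp(i κ t)` as a smooth function. -/
def expFun (κ : ℝ) : SmoothFun :=
  ⟨fun t => Complex.exp (κ * t * Complex.I),
    show ContDiff ℝ ∞ fun t : ℝ => Complex.exp (κ * t * Complex.I) from
      Complex.contDiff_exp.comp
        ((contDiff_const.mul Complex.ofRealCLM.contDiff).mul contDiff_const)⟩

theorem contDiff_expFun (κ : ℝ) : ContDiff ℝ ∞ (expFun κ).1 := (expFun κ).2

theorem norm_expFun (κ t : ℝ) : ‖(expFun κ).1 t‖ = 1 := by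
  simpa [expFun] using Complex.norm_exp_ofReal_mul_I (κ * t)

theorem norm_iteratedDeriv_expFun (κ : ℝ) (j : ℕ) (t : ℝ) :
    ‖iteratedDeriv j (expFun κ).1 t‖ = |κ| ^ j := by
  have h : iteratedDeriv j (expFun κ).1 = fun t => (κ * Complex.I) ^ j * (expFun κ).1 t := by
    induction j with
    | zero => simp
    | succ j ih =>
      rw [iteratedDeriv_succ, ih]
      funext t
      have h₁ : HasDerivAt (fun t : ℝ => (κ : ℂ) * t * Complex.I) (κ * Complex.I) t := by
        simpa using ((hasDerivAt_id t).ofReal_comp.const_mul (κ : ℂ)).mul_const Complex.I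
      change deriv (fun t : ℝ => (κ * Complex.I) ^ j * Complex.exp (κ * t * Complex.I)) t = _
      rw [(h₁.cexp.const_mul _).deriv]
      simp only [expFun]
      ring
  rw [h, norm_mul, norm_expFun]
  simp

/-- The damping factor `(1 + |κₙ|)⁻ⁿ` dominates any fixed power of `κₙ` for all but finitely many
`n`, so that an `ℓ¹` superposition of the damped exponentials may be differentiated termwise. -/
theorem summable_dampedExp (κ : ℕ → ℝ) (a : lp (fun _ : ℕ => ℂ) 1) (j : ℕ) :
    Summable fun N => ‖a N‖ * (((1 + |κ N|) ^ N)⁻¹ * |κ N| ^ j) := by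
  have ha : Summable fun N => ‖a N‖ := by simpa using (lp.memℓp a).summable (by simp)
  refine Summable.of_norm_bounded_eventually_nat ha ?_
  filter_upwards [Filter.eventually_ge_atTop j] with N hN
  have h0 : (0 : ℝ) < (1 + |κ N|) ^ N := by positivity
  rw [Real.norm_of_nonneg (by positivity)]
  refine mul_le_of_le_one_right (norm_nonneg _) ?_
  rw [inv_mul_le_iff₀ h0, mul_one]
  calc |κ N| ^ j ≤ (1 + |κ N|) ^ j := by gcongr; linarith
    _ ≤ (1 + |κ N|) ^ N := pow_le_pow_right₀ (by linarith [abs_nonneg (κ N)]) hN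

/-- The term `a_N (1 + |κ_N|)⁻ᴺ exp(i κ_N t)` of a damped superposition of exponentials. -/
def dampedTerm (κ : ℕ → ℝ) (a : ℕ → ℂ) (N : ℕ) : ℝ → ℂ :=
  (a N * (((1 + |κ N|) ^ N : ℝ) : ℂ)⁻¹) • (expFun (κ N)).1

theorem contDiff_dampedTerm (κ : ℕ → ℝ) (a : ℕ → ℂ) (N : ℕ) :
    ContDiff ℝ ∞ (dampedTerm κ a N) :=
  contDiff_const.smul (contDiff_expFun _)

theorem norm_iteratedFDeriv_dampedTerm (κ : ℕ → ℝ) (a : ℕ → ℂ) (N j : ℕ) (t : ℝ) :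
    ‖iteratedFDeriv ℝ j (dampedTerm κ a N) t‖ ≤
      ‖a N‖ * (((1 + |κ N|) ^ N)⁻¹ * |κ N| ^ j) := by
  rw [dampedTerm, iteratedFDeriv_const_smul_apply
    ((contDiff_expFun _).of_le (by exact_mod_cast le_top)).contDiffAt, norm_smul,
    norm_iteratedFDeriv_eq_norm_iteratedDeriv, norm_iteratedDeriv_expFun, norm_mul, norm_inv,
    Complex.norm_real, Real.norm_of_nonneg (by positivity), mul_assoc]

theorem norm_dampedTerm (κ : ℕ → ℝ) (a : ℕ → ℂ) (N : ℕ) (t : ℝ) :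
    ‖dampedTerm κ a N t‖ ≤ ‖a N‖ * (((1 + |κ N|) ^ N)⁻¹ * |κ N| ^ 0) := by
  simpa using norm_iteratedFDeriv_dampedTerm κ a N 0 t

theorem summable_dampedTerm (κ : ℕ → ℝ) (a : lp (fun _ : ℕ => ℂ) 1) (t : ℝ) :
    Summable fun N => dampedTerm κ a N t :=
  Summable.of_norm_bounded (summable_dampedExp κ a 0) fun N => norm_dampedTerm κ a N t

/-- The damped superposition `∑ a_N (1 + |κ_N|)⁻ᴺ exp(i κ_N t)`, as a linear map of `a ∈ ℓ¹`. -/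
def dampedExp (κ : ℕ → ℝ) : lp (fun _ : ℕ => ℂ) 1 →ₗ[ℂ] SmoothFun where
  toFun a := ⟨fun t => ∑' N, dampedTerm κ a N t,
    contDiff_tsum (fun N => contDiff_dampedTerm κ a N) (fun j _ => summable_dampedExp κ a j)
      fun j N t _ => norm_iteratedFDeriv_dampedTerm κ a N j t⟩
  map_add' a b := by
    ext t
    have h := (summable_dampedTerm κ a t).tsum_add (summable_dampedTerm κ b t)
    simpa [dampedTerm, add_mul] using h
  map_smul' c a := by
    ext t
    have h := (summable_dampedTerm κ a t).tsum_mul_left c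
    simpa [dampedTerm, mul_assoc] using h

theorem norm_iteratedDeriv_dampedExp_le (κ : ℕ → ℝ) (a : lp (fun _ : ℕ => ℂ) 1) (j : ℕ) (t : ℝ) :
    ‖iteratedDeriv j (dampedExp κ a).1 t‖ ≤
      ∑' N, ‖a N‖ * (((1 + |κ N|) ^ N)⁻¹ * |κ N| ^ j) := by
  rw [← norm_iteratedFDeriv_eq_norm_iteratedDeriv]
  change ‖iteratedFDeriv ℝ j (fun t => ∑' N, dampedTerm κ a N t) t‖ ≤ _
  rw [iteratedFDeriv_tsum_apply (N := ⊤) (fun N => contDiff_dampedTerm κ a N)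
    (fun j _ => summable_dampedExp κ a j)
    (fun j N t _ => norm_iteratedFDeriv_dampedTerm κ a N j t) le_top]
  exact tsum_of_norm_bounded (summable_dampedExp κ a j).hasSum
    fun N => norm_iteratedFDeriv_dampedTerm κ a N j t

theorem norm_dampedExp_le (κ : ℕ → ℝ) (a : lp (fun _ : ℕ => ℂ) 1) (t : ℝ) :
    ‖(dampedExp κ a).1 t‖ ≤ ‖a‖ := by
  have ha : Summable fun N => ‖a N‖ := by simpa using (lp.memℓp a).summable (by simp)
  have hn : ‖a‖ = ∑' N, ‖a N‖ := by simpa using lp.norm_eq_tsum_rpow (p := 1) (by simp) a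
  rw [hn]
  refine tsum_of_norm_bounded ha.hasSum fun N => (norm_dampedTerm κ a N t).trans ?_
  refine mul_le_of_le_one_right (norm_nonneg _) ?_
  rw [pow_zero, mul_one]
  exact inv_le_one_of_one_le₀ (one_le_pow₀ (by linarith [abs_nonneg (κ N)]))

theorem dampedExp_single (κ : ℕ → ℝ) (N : ℕ) :
    dampedExp κ (lp.single 1 N 1) = (((1 + |κ N|) ^ N : ℝ) : ℂ)⁻¹ • expFun (κ N) := by
  ext t
  change ∑' M, dampedTerm κ (lp.single 1 N (1 : ℂ)) M t = _
  rw [tsum_eq_single N fun M hM => ?_]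
  · simp [dampedTerm]
  · simp [dampedTerm, Pi.single_eq_of_ne hM]

/-- A form of the uniform boundedness principle. If a family of functionals satisfies, for every
smooth `g` with bounded derivatives, an estimate whose constant and order depend on `g`, then on
the exponentials it satisfies an estimate of one order, with constants of polynomial growth in the
frequency. -/
theorem exists_uniform_bound_expFun {Θ : Type*} (Λ : Θ → SmoothFun →ₗ[ℂ] ℂ) (K : Θ → ℝ)
    (hK : ∀ θ g B, (∀ t, ‖g.1 t‖ ≤ B) → ‖Λ θ g‖ ≤ K θ * B) (W : Θ → ℕ → ℝ)
    (hW₀ : ∀ θ N, 0 ≤ W θ N) (hW : ∀ θ, Monotone (W θ))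
    (h : ∀ g : SmoothFun, (∀ j : ℕ, ∃ B : ℝ, ∀ t : ℝ, ‖iteratedDeriv j g.1 t‖ ≤ B) →
      ∃ C : ℝ, ∃ N : ℕ, 0 ≤ C ∧ ∀ θ, ‖Λ θ g‖ ≤ C * W θ N) :
    ∃ N : ℕ, ∀ κ θ, ‖Λ θ (expFun κ)‖ ≤ (N + 1) * (1 + |κ|) ^ N * W θ N := by
  -- Otherwise each order `N` fails for some frequency `κ N` and some functional; superpositions of
  -- these countably many exponentials, damped so as to have bounded derivatives, form a Banach
  -- space to which the Banach–Steinhaus theorem applies.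
  by_contra! hcon
  choose κ θ hκ using hcon
  have hD : ∀ N : ℕ, 0 < ((N : ℝ) + 1) * (1 + |κ N|) ^ N := fun N => by positivity
  -- The normalisation is chosen so that the `N`-th functional has size `N + 1` on the `N`-th
  -- basis vector.
  set v : ℕ → ℝ := fun N => ‖Λ (θ N) (expFun (κ N))‖ / (((N : ℝ) + 1) * (1 + |κ N|) ^ N) with hv
  have hvW : ∀ N, W (θ N) N < v N := fun N => by
    rw [hv, lt_div_iff₀ (hD N), mul_comm]
    exact hκ N
  have hv₀ : ∀ N, 0 < v N := fun N => (hW₀ _ _).trans_lt (hvW N)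
  let T : ℕ → lp (fun _ : ℕ => ℂ) 1 →L[ℂ] ℂ := fun N =>
    LinearMap.mkContinuous (((v N : ℝ) : ℂ)⁻¹ • (Λ (θ N) ∘ₗ dampedExp κ)) ((v N)⁻¹ * K (θ N))
      fun a => by
        rw [LinearMap.smul_apply, norm_smul, norm_inv, Complex.norm_real,
          Real.norm_of_nonneg (hv₀ N).le, mul_assoc]
        exact mul_le_mul_of_nonneg_left (hK _ _ _ (norm_dampedExp_le κ a))
          (inv_nonneg.2 (hv₀ N).le)
  have hT : ∀ N a, ‖T N a‖ = (v N)⁻¹ * ‖Λ (θ N) (dampedExp κ a)‖ := fun N a => by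
    simp [T, abs_of_pos (hv₀ N)]
  obtain ⟨C, hC⟩ := banach_steinhaus (g := T) fun a => by
    obtain ⟨C, M, hC₀, hC⟩ := h (dampedExp κ a) fun j => ⟨_, norm_iteratedDeriv_dampedExp_le κ a j⟩
    refine ⟨C + ∑ N ∈ Finset.range M, ‖T N a‖, fun N => ?_⟩
    -- From the order `M` of the estimate for `dampedExp κ a` on, monotonicity of `W` applies.
    rcases lt_or_ge N M with hN | hN
    · have : ‖T N a‖ ≤ ∑ N ∈ Finset.range M, ‖T N a‖ :=
        Finset.single_le_sum (f := fun N => ‖T N a‖) (fun i _ => norm_nonneg _)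
          (Finset.mem_range.2 hN)
      linarith
    · have h₁ : ‖T N a‖ ≤ C := by
        rw [hT, inv_mul_le_iff₀ (hv₀ N), mul_comm]
        exact (hC _).trans (mul_le_mul_of_nonneg_left ((hW _ hN).trans (hvW N).le) hC₀)
      exact h₁.trans (le_add_of_nonneg_right (Finset.sum_nonneg fun _ _ => norm_nonneg _))
  obtain ⟨N, hN⟩ := exists_nat_gt C
  have h₁ := (T N).le_of_opNorm_le (hC N) (lp.single 1 N 1)
  have h₂ : ‖T N (lp.single 1 N 1)‖ = N + 1 := by
    have hne : ‖Λ (θ N) (expFun (κ N))‖ ≠ 0 := fun h0 => by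
      have := hv₀ N
      simp [hv, h0] at this
    have hp : (0 : ℝ) < (1 + |κ N|) ^ N := by positivity
    rw [hT, dampedExp_single, map_smul, norm_smul, norm_inv, Complex.norm_real,
      Real.norm_of_nonneg hp.le, hv]
    have : (N : ℝ) + 1 ≠ 0 := by positivity
    field_simp
  rw [h₂, lp.norm_single (by simp), norm_one, mul_one] at h₁
  linarith

/-! ### The a priori estimate for characters of high frequency -/

/-- The functional `g ↦ ∫ waveLift g * φ`. -/
def wavePairing (σ γ η : ℝ) (φ : SmoothH1) (hφ : HasCompactSupport φ.1) : SmoothFun →ₗ[ℂ] ℂ where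
  toFun g := ∫ q, (waveLift σ γ η g).1 q * φ.1 q
  map_add' g h := by
    rw [← integral_add (smoothH1_integrable_mul _ φ hφ) (smoothH1_integrable_mul _ φ hφ)]
    simp [add_mul]
  map_smul' c g := by
    rw [RingHom.id_apply, smul_eq_mul, ← integral_const_mul]
    simp [mul_assoc]

theorem norm_wavePairing_le (σ γ η : ℝ) (φ : SmoothH1) (hφ : HasCompactSupport φ.1)
    (g : SmoothFun) (B : ℝ) (hg : ∀ t, ‖g.1 t‖ ≤ B) :
    ‖wavePairing σ γ η φ hφ g‖ ≤ (∫ q, ‖φ.1 q‖) * B := by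
  rw [← integral_mul_const]
  refine norm_integral_le_of_norm_le ?_ (Filter.Eventually.of_forall fun q => ?_)
  · exact ((smoothH1_continuous φ).integrable_of_hasCompactSupport hφ).norm.mul_const B
  · rw [norm_mul, norm_waveLift, mul_comm]
    exact mul_le_mul_of_nonneg_left (hg _) (norm_nonneg _)

/-- The size of `ψ`, weighted by a power of the size of the arguments of the parametrix. -/
def waveWeight (σ γ η : ℝ) (ψ : SmoothH1) (N : ℕ) : ℝ :=
  ∫ q : H1, (1 + |γ * q.1 + σ * η / γ| + |γ|) ^ N * ‖ψ.1 q‖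

theorem integrable_waveWeight (σ γ η : ℝ) {ψ : SmoothH1} (hψ : HasCompactSupport ψ.1) (N : ℕ) :
    Integrable fun q : H1 => (1 + |γ * q.1 + σ * η / γ| + |γ|) ^ N * ‖ψ.1 q‖ := by
  refine Continuous.integrable_of_hasCompactSupport ?_ hψ.norm.mul_left
  have := smoothH1_continuous ψ
  fun_prop

theorem monotone_waveWeight (σ γ η : ℝ) {ψ : SmoothH1} (hψ : HasCompactSupport ψ.1) :
    Monotone (waveWeight σ γ η ψ) := fun N M hNM => by
  refine integral_mono (integrable_waveWeight σ γ η hψ N) (integrable_waveWeight σ γ η hψ M)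
    fun q => ?_
  have : 1 ≤ 1 + |γ * q.1 + σ * η / γ| + |γ| := by
    linarith [abs_nonneg (γ * q.1 + σ * η / γ), abs_nonneg γ]
  dsimp only
  gcongr

/-- Each `g` has its own parametrix, with its own order of growth; the uniform boundedness principle
turns this into an estimate for all the exponentials at once. -/
theorem exists_bound_waveLift_expFun {n : ℕ} {P : ℕ → NCPoly}
    (hP : ∀ l ≤ n, (P l).IsHomogeneous l) {γ₀ : ℝ} (hγ₀ : 0 < γ₀) {σ : ℝ} (hσ : σ ^ 2 = 1)
    (hpar : HasRegularParametrix (realization n P (-σ)) γ₀) :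
    ∃ N : ℕ, ∀ κ γ η : ℝ, γ₀ < γ → ∀ φ : SmoothH1, HasCompactSupport φ.1 →
      ‖∫ q, (waveLift σ γ η (expFun κ)).1 q * φ.1 q‖ ≤ (N + 1) * (1 + |κ|) ^ N *
        waveWeight σ γ η (formalTranspose (∑ l ∈ Finset.range (n + 1), P l) φ) N := by
  set Q := ∑ l ∈ Finset.range (n + 1), P l
  have hc : ∀ φ : SmoothH1, HasCompactSupport φ.1 → HasCompactSupport (formalTranspose Q φ).1 :=
    fun φ hφ => (isTranspose_formalTranspose Q).hasCompactSupport hφ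
  have hest : ∀ g : SmoothFun, (∀ j : ℕ, ∃ B : ℝ, ∀ t : ℝ, ‖iteratedDeriv j g.1 t‖ ≤ B) →
      ∃ C : ℝ, ∃ N : ℕ, 0 ≤ C ∧
        ∀ θ : {θ : ℝ × ℝ × SmoothH1 // γ₀ < θ.1 ∧ HasCompactSupport θ.2.2.1},
          ‖wavePairing σ θ.1.1 θ.1.2.1 θ.1.2.2 θ.2.2 g‖ ≤
            C * waveWeight σ θ.1.1 θ.1.2.1 (formalTranspose Q θ.1.2.2) N := by
    intro g hg
    obtain ⟨F, -, hF, hFb⟩ := hpar g hg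
    obtain ⟨a, C, -, hC, hb⟩ := hFb 0
    refine ⟨(γ₀ ^ n)⁻¹ * C, ⌈a⌉₊, by positivity, ?_⟩
    rintro ⟨⟨γ, η, φ⟩, hγ, hφ⟩
    dsimp only at hγ hφ ⊢
    have hγp : 0 < γ := hγ₀.trans hγ
    refine (norm_integral_waveLift_le hσ hγp η hP (hF γ hγ)
      (W := fun t => C * (1 + |t| + |γ|) ^ ⌈a⌉₊) (by fun_prop) (fun t => ?_) hφ).trans ?_
    · refine (by simpa using hb 0 le_rfl t γ hγ : ‖(F γ).1 t‖ ≤ _).trans ?_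
      gcongr
      rw [← Real.rpow_natCast]
      refine Real.rpow_le_rpow_of_exponent_le ?_ (Nat.le_ceil a)
      linarith [abs_nonneg t, abs_nonneg γ]
    · simp only [mul_assoc, integral_const_mul]
      have : 0 ≤ waveWeight σ γ η (formalTranspose Q φ) ⌈a⌉₊ :=
        integral_nonneg fun q => by positivity
      change (γ ^ n)⁻¹ * (C * waveWeight σ γ η (formalTranspose Q φ) ⌈a⌉₊) ≤ _
      gcongr
  obtain ⟨N, hN⟩ := exists_uniform_bound_expFun _ (fun θ => ∫ q, ‖θ.1.2.2.1 q‖)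
    (fun θ => norm_wavePairing_le σ θ.1.1 θ.1.2.1 θ.1.2.2 θ.2.2) _
    (fun θ N => integral_nonneg fun q => by positivity)
    (fun θ => monotone_waveWeight _ _ _ (hc _ θ.2.2)) hest
  exact ⟨N, fun κ γ η hγ φ hφ => hN κ ⟨(γ, η, φ), hγ, hφ⟩⟩

/-- The character of `ℝ³` given by `exp(i (ξ x + η y + μ w))`. -/
def character (ξ η μ : ℝ) (q : H1) : ℂ :=
  Complex.exp ((ξ * q.1 + η * q.2.1 + μ * q.2.2 : ℝ) * Complex.I)

theorem norm_character (ξ η μ : ℝ) (q : H1) : ‖character ξ η μ q‖ = 1 :=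
  Complex.norm_exp_ofReal_mul_I _

/-- A character of frequency `σ γ²` in `w` is, up to a constant phase, the wave of an
exponential. -/
theorem norm_integral_character_eq {σ γ : ℝ} (hγ : γ ≠ 0) (ξ η : ℝ) (φ : H1 → ℂ) :
    ‖∫ q, character ξ η (σ * γ ^ 2) q * φ q‖ =
      ‖∫ q, (waveLift σ γ η (expFun (ξ / γ))).1 q * φ q‖ := by
  have h : ∀ q, (waveLift σ γ η (expFun (ξ / γ))).1 q =
      Complex.exp ((ξ * σ * η / γ ^ 2 : ℝ) * Complex.I) * character ξ η (σ * γ ^ 2) q := by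
    intro q
    have hγ' : (γ : ℂ) ≠ 0 := by exact_mod_cast hγ
    simp only [waveLift, expFun, character, wavePhase, LinearMap.coe_mk, AddHom.coe_mk]
    rw [← Complex.exp_add, ← Complex.exp_add]
    congr 1
    push_cast
    field_simp
    ring
  simp only [h, mul_assoc]
  rw [integral_const_mul, norm_mul, Complex.norm_exp_ofReal_mul_I, one_mul]

theorem waveWeight_le {σ γ γ₀ R : ℝ} (hσ : σ ^ 2 = 1) (hγ₀ : 0 < γ₀) (hγ : γ₀ < γ) (hR : 0 ≤ R)
    (η : ℝ) {ψ : SmoothH1} (hψ : HasCompactSupport ψ.1)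
    (hs : tsupport ψ.1 ⊆ {q : H1 | |q.1| ≤ R}) (N : ℕ) :
    waveWeight σ γ η ψ N ≤ ((2 + R + γ₀⁻¹) * (1 + |η| + γ ^ 2)) ^ N * ∫ q, ‖ψ.1 q‖ := by
  have hγp : 0 < γ := hγ₀.trans hγ
  rw [← integral_const_mul]
  refine integral_mono (integrable_waveWeight σ γ η hψ N)
    (((smoothH1_continuous ψ).integrable_of_hasCompactSupport hψ).norm.const_mul _) fun q => ?_
  by_cases hq : q ∈ tsupport ψ.1
  · have hq' : |q.1| ≤ R := hs hq
    dsimp only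
    gcongr
    have h₁ : |γ * q.1 + σ * η / γ| ≤ γ * R + γ₀⁻¹ * |η| := by
      refine (abs_add_le _ _).trans (add_le_add ?_ ?_)
      · rw [abs_mul, abs_of_pos hγp]
        gcongr
      · have : |σ| = 1 := by
          rw [← sq_eq_sq₀ (abs_nonneg σ) zero_le_one, sq_abs, hσ, one_pow]
        rw [abs_div, abs_mul, this, one_mul, abs_of_pos hγp, div_eq_inv_mul]
        gcongr
    have h₂ : γ ≤ 1 + γ ^ 2 := by nlinarith [sq_nonneg (γ - 1)]
    have h₃ : γ * R ≤ (1 + γ ^ 2) * R := by gcongr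
    have h₄ : 0 < γ₀⁻¹ := by positivity
    rw [abs_of_pos hγp]
    have h₅ : 0 ≤ γ₀⁻¹ * (1 + γ ^ 2) := by positivity
    have h₆ : 0 ≤ (2 + R) * |η| := by positivity
    nlinarith [sq_nonneg γ]
  · rw [image_eq_zero_of_notMem_tsupport hq]
    simp

theorem exists_bound_character_of_sign {n : ℕ} {P : ℕ → NCPoly}
    (hP : ∀ l ≤ n, (P l).IsHomogeneous l) {γ₀ : ℝ} (hγ₀ : 0 < γ₀) {σ : ℝ} (hσ : σ ^ 2 = 1)
    (hpar : HasRegularParametrix (realization n P (-σ)) γ₀) {R : ℝ} (hR : 0 ≤ R) :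
    ∃ C : ℝ, ∃ M : ℕ, 0 ≤ C ∧ ∀ ξ η γ : ℝ, γ₀ < γ → ∀ φ : SmoothH1, HasCompactSupport φ.1 →
      tsupport φ.1 ⊆ {q : H1 | |q.1| ≤ R} →
      ‖∫ q, character ξ η (σ * γ ^ 2) q * φ.1 q‖ ≤ C * (1 + |ξ| + |η| + γ ^ 2) ^ M *
        ∫ q, ‖(formalTranspose (∑ l ∈ Finset.range (n + 1), P l) φ).1 q‖ := by
  set Q := ∑ l ∈ Finset.range (n + 1), P l
  obtain ⟨N, hN⟩ := exists_bound_waveLift_expFun hP hγ₀ hσ hpar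
  refine ⟨(N + 1) * (1 + γ₀⁻¹) ^ N * (2 + R + γ₀⁻¹) ^ N, N + N, by positivity,
    fun ξ η γ hγ φ hφ hs => ?_⟩
  have hγp : 0 < γ := hγ₀.trans hγ
  have hT := isTranspose_formalTranspose Q
  rw [norm_integral_character_eq hγp.ne']
  refine (hN (ξ / γ) γ η hγ φ hφ).trans ?_
  have h₁ : 1 + |ξ / γ| ≤ (1 + γ₀⁻¹) * (1 + |ξ| + |η| + γ ^ 2) := by
    have h₂ : |ξ / γ| ≤ γ₀⁻¹ * |ξ| := by
      rw [abs_div, abs_of_pos hγp, div_eq_inv_mul]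
      gcongr
    have h₃ : 0 ≤ γ₀⁻¹ * (1 + |η| + γ ^ 2) := by positivity
    nlinarith [abs_nonneg ξ, abs_nonneg η, sq_nonneg γ]
  have h₄ : 1 + |η| + γ ^ 2 ≤ 1 + |ξ| + |η| + γ ^ 2 := by linarith [abs_nonneg ξ]
  calc _ ≤ (N + 1) * ((1 + γ₀⁻¹) * (1 + |ξ| + |η| + γ ^ 2)) ^ N *
        (((2 + R + γ₀⁻¹) * (1 + |ξ| + |η| + γ ^ 2)) ^ N * ∫ q, ‖(formalTranspose Q φ).1 q‖) := by
        refine mul_le_mul ?_ ((waveWeight_le hσ hγ₀ hγ hR η (hT.hasCompactSupport hφ)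
          ((hT φ hφ).1.trans hs) N).trans ?_) (integral_nonneg fun q => by positivity)
          (by positivity)
        · gcongr
        · have : 0 ≤ ∫ q, ‖(formalTranspose Q φ).1 q‖ := integral_nonneg fun q => norm_nonneg _
          gcongr
    _ = _ := by
        rw [mul_pow, mul_pow, pow_add]
        ring

/-- The a priori estimate: the Fourier transform of `φ` at frequencies `μ` large in the central
variable is controlled by the `L¹` norm of the formal transpose of `P(X, Y)` applied to `φ`. -/
theorem exists_bound_character {n : ℕ} {P : ℕ → NCPoly}
    (hP : ∀ l ≤ n, (P l).IsHomogeneous l) {γ₀ : ℝ} (hγ₀ : 0 < γ₀)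
    (hplus : HasRegularParametrix (realization n P 1) γ₀)
    (hminus : HasRegularParametrix (realization n P (-1)) γ₀) {R : ℝ} (hR : 0 ≤ R) :
    ∃ C : ℝ, ∃ M : ℕ, 0 ≤ C ∧ ∀ ξ η μ : ℝ, γ₀ ^ 2 < |μ| → ∀ φ : SmoothH1,
      HasCompactSupport φ.1 → tsupport φ.1 ⊆ {q : H1 | |q.1| ≤ R} →
      ‖∫ q, character ξ η μ q * φ.1 q‖ ≤ C * (1 + |ξ| + |η| + |μ|) ^ M *
        ∫ q, ‖(formalTranspose (∑ l ∈ Finset.range (n + 1), P l) φ).1 q‖ := by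
  set Q := ∑ l ∈ Finset.range (n + 1), P l
  obtain ⟨C₁, M₁, hC₁, h₁⟩ := exists_bound_character_of_sign hP hγ₀ (σ := 1) (by norm_num)
    (by simpa using hminus) hR
  obtain ⟨C₂, M₂, hC₂, h₂⟩ := exists_bound_character_of_sign hP hγ₀ (σ := -1) (by norm_num)
    (by simpa using hplus) hR
  refine ⟨C₁ + C₂, M₁ + M₂, add_nonneg hC₁ hC₂, fun ξ η μ hμ φ hφ hs => ?_⟩
  have hγ : γ₀ < √|μ| := (Real.lt_sqrt hγ₀.le).2 hμ
  have hsq : √|μ| ^ 2 = |μ| := Real.sq_sqrt (abs_nonneg μ)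
  have hI : 0 ≤ ∫ q, ‖(formalTranspose Q φ).1 q‖ := integral_nonneg fun q => norm_nonneg _
  have hr : 1 ≤ 1 + |ξ| + |η| + |μ| := by linarith [abs_nonneg ξ, abs_nonneg η, abs_nonneg μ]
  rcases le_total 0 μ with h | h
  · have hb := h₁ ξ η _ hγ φ hφ hs
    rw [hsq, one_mul, abs_of_nonneg h] at hb
    rw [abs_of_nonneg h] at hr ⊢
    refine hb.trans (mul_le_mul_of_nonneg_right (mul_le_mul (le_add_of_nonneg_right hC₂)
      (pow_le_pow_right₀ hr (Nat.le_add_right _ _)) (by positivity) (add_nonneg hC₁ hC₂)) hI)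
  · have hb := h₂ ξ η _ hγ φ hφ hs
    rw [hsq, abs_of_nonpos h, neg_one_mul, neg_neg] at hb
    rw [abs_of_nonpos h] at hr ⊢
    refine hb.trans (mul_le_mul_of_nonneg_right (mul_le_mul (le_add_of_nonneg_left hC₁)
      (pow_le_pow_right₀ hr (Nat.le_add_left _ _)) (by positivity) (add_nonneg hC₁ hC₂)) hI)

/-! ### Superposition of characters of high frequency -/

/-- The coordinates of `H1`, as an isomorphism with a Euclidean space. -/
def euclideanEquivH1 : EuclideanSpace ℝ (Fin 3) ≃L[ℝ] H1 :=
  LinearEquiv.toContinuousLinearEquiv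
    { toFun := fun v => (v 0, v 1, v 2)
      map_add' := fun _ _ => rfl
      map_smul' := fun _ _ => rfl
      invFun := fun q => !₂[q.1, q.2.1, q.2.2]
      left_inv := fun v => by
        ext i
        fin_cases i <;> rfl
      right_inv := fun _ => rfl }

/-- The character of frequency `2π ζ`. -/
def fourierCharacter (ζ : EuclideanSpace ℝ (Fin 3)) (q : H1) : ℂ :=
  character (2 * Real.pi * ζ 0) (2 * Real.pi * ζ 1) (2 * Real.pi * ζ 2) q

theorem norm_fourierCharacter (ζ : EuclideanSpace ℝ (Fin 3)) (q : H1) :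
    ‖fourierCharacter ζ q‖ = 1 :=
  norm_character _ _ _ _

theorem continuous_fourierCharacter :
    Continuous fun z : H1 × EuclideanSpace ℝ (Fin 3) => fourierCharacter z.2 z.1 := by
  unfold fourierCharacter character
  fun_prop

/-- Fourier inversion on `H1`, with the frequencies in a Euclidean space. -/
theorem exists_eq_integral_fourierCharacter {f : H1 → ℂ} (hf : ContDiff ℝ ∞ f)
    (hc : HasCompactSupport f) :
    ∃ G : 𝓢(EuclideanSpace ℝ (Fin 3), ℂ), ∀ q, f q = ∫ ζ, fourierCharacter ζ q * G ζ := by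
  have hc' : HasCompactSupport (f ∘ euclideanEquivH1) :=
    hc.comp_homeomorph euclideanEquivH1.toHomeomorph
  let F : 𝓢(EuclideanSpace ℝ (Fin 3), ℂ) :=
    hc'.toSchwartzMap (hf.comp euclideanEquivH1.contDiff)
  refine ⟨𝓕 F, fun q => ?_⟩
  have h₁ : 𝓕⁻ (𝓕 F) = F := fourierInv_fourier_eq F
  have h₂ : f q = 𝓕⁻ (𝓕 F) (euclideanEquivH1.symm q) := by
    rw [h₁]
    simp [F]
  rw [h₂, SchwartzMap.fourierInv_coe, Real.fourierInv_eq']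
  refine integral_congr_ae (Filter.Eventually.of_forall fun ζ => ?_)
  dsimp only
  rw [smul_eq_mul]
  congr 1
  unfold fourierCharacter character
  congr 2
  have h₃ : euclideanEquivH1.symm q = !₂[q.1, q.2.1, q.2.2] := rfl
  rw [h₃]
  simp [PiLp.inner_apply, Fin.sum_univ_three]
  ring

/-- There is an absolutely convergent trigonometric series of period `1` that vanishes near the
integers and has mean value different from zero. -/
theorem exists_trigonometric_series_eq_zero :
    ∃ c : ℤ → ℂ, (Summable fun k => ‖c k‖) ∧ c 0 ≠ 0 ∧ ∀ s : ℝ, |s| ≤ 1 / 4 →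
      ∑' k : ℤ, c k * Complex.exp (2 * Real.pi * Complex.I * k * s) = 0 := by
  -- The series is the periodization of a bump supported in the middle of the period, expanded by
  -- Poisson summation.
  let b : ContDiffBump (1 / 2 : ℝ) := ⟨1 / 8, 1 / 4, by norm_num, by norm_num⟩
  have hb : ContDiff ℝ ∞ fun s : ℝ => (b s : ℂ) := Complex.ofRealCLM.contDiff.comp b.contDiff
  have hc : HasCompactSupport fun s : ℝ => (b s : ℂ) :=
    b.hasCompactSupport.comp_left (g := fun r : ℝ => (r : ℂ)) Complex.ofReal_zero
  let ψ : 𝓢(ℝ, ℂ) := hc.toSchwartzMap hb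
  refine ⟨fun k => 𝓕 ψ k, ?_, ?_, fun s hs => ?_⟩
  · refine Summable.norm ?_
    exact summable_of_isBigO (Real.summable_abs_int_rpow one_lt_two)
      (((𝓕 ψ).isBigO_cocompact_rpow (-2)).comp_tendsto Int.tendsto_coe_cofinite)
  · have h₁ : 𝓕 ψ ((0 : ℤ) : ℝ) = ((∫ s, b s : ℝ) : ℂ) := by
      rw [SchwartzMap.fourier_coe, Real.fourier_eq', ← integral_complex_ofReal]
      simp [ψ]
    change 𝓕 ψ ((0 : ℤ) : ℝ) ≠ 0
    rw [h₁]
    exact_mod_cast b.integral_pos.ne'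
  · have h := SchwartzMap.tsum_eq_tsum_fourier ψ s
    have h₀ : ∀ n : ℤ, ψ (s + n) = 0 := by
      intro n
      have : b (s + n) = 0 := by
        refine b.zero_of_le_dist ?_
        change 1 / 4 ≤ dist (s + n) (1 / 2)
        rw [Real.dist_eq]
        obtain ⟨hs₁, hs₂⟩ := abs_le.1 hs
        rcases le_or_gt n 0 with hn | hn
        · have : (n : ℝ) ≤ 0 := by exact_mod_cast hn
          rw [le_abs]
          right
          linarith
        · have : (1 : ℝ) ≤ n := by exact_mod_cast hn
          rw [le_abs]
          left
          linarith
      simp [ψ, this]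
    simp only [h₀, tsum_zero] at h
    rw [h]
    refine tsum_congr fun k => ?_
    rw [fourier_coe_apply]
    simp

theorem integrable_pow_mul_norm (G : 𝓢(EuclideanSpace ℝ (Fin 3), ℂ)) (A : ℝ) (M : ℕ) :
    Integrable fun ζ => (A * ‖ζ‖ + 1) ^ M * ‖G ζ‖ := by
  simp only [add_pow, Finset.sum_mul, one_pow, mul_one]
  refine integrable_finsetSum _ fun k _ => ?_
  convert! (G.integrable_pow_mul volume k).const_mul (A ^ k * (M.choose k : ℝ)) using 2
  ring

theorem fourierCharacter_translate (ζ : EuclideanSpace ℝ (Fin 3)) (q : H1) (a : ℝ) (k : ℤ) :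
    fourierCharacter ζ (q + (0, 0, k * a)) =
      Complex.exp (2 * Real.pi * Complex.I * k * (a * ζ 2 : ℝ)) * fourierCharacter ζ q := by
  unfold fourierCharacter character
  rw [← Complex.exp_add]
  congr 1
  simp
  ring

/-- Adding to `f` a suitable combination of its translates in the central direction removes its
low frequencies in that direction. On a set disjoint from its translates this does not change
`f`, up to a constant. -/
theorem exists_const_mul_eq_integral {f : H1 → ℂ} (hf : ContDiff ℝ ∞ f)
    (hc : HasCompactSupport f) {a : ℝ} {U : Set H1} (hfU : tsupport f ⊆ U)
    (hU : ∀ q ∈ U, ∀ k : ℤ, k ≠ 0 → q + (0, 0, k * a) ∉ U) :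
    ∃ (c : ℂ) (G : 𝓢(EuclideanSpace ℝ (Fin 3), ℂ)) (m : ℝ → ℂ) (B : ℝ), c ≠ 0 ∧ Continuous m ∧
      (∀ s, ‖m s‖ ≤ B) ∧ (∀ s, |s| ≤ 1 / 4 → m s = 0) ∧
      ∀ q ∈ U, c * f q = ∫ ζ, fourierCharacter ζ q * (m (a * ζ 2) * G ζ) := by
  obtain ⟨G, hG⟩ := exists_eq_integral_fourierCharacter hf hc
  obtain ⟨c, hcs, hc₀, hcz⟩ := exists_trigonometric_series_eq_zero
  have hn : ∀ (k : ℤ) (s : ℝ), ‖c k * Complex.exp (2 * Real.pi * Complex.I * k * s)‖ ≤ ‖c k‖ := by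
    intro k s
    have : 2 * Real.pi * Complex.I * k * s = ((2 * Real.pi * k * s : ℝ) : ℂ) * Complex.I := by
      push_cast
      ring
    rw [norm_mul, this, Complex.norm_exp_ofReal_mul_I, mul_one]
  refine ⟨c 0, G, fun s => ∑' k : ℤ, c k * Complex.exp (2 * Real.pi * Complex.I * k * s),
    ∑' k, ‖c k‖, hc₀, continuous_tsum (fun k => by fun_prop) hcs hn,
    fun s => tsum_of_norm_bounded hcs.hasSum fun k => hn k s, hcz, fun q hq => ?_⟩
  have hcont : Continuous fun ζ : EuclideanSpace ℝ (Fin 3) => fourierCharacter ζ q :=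
    continuous_fourierCharacter.comp (by fun_prop : Continuous fun ζ => (q, ζ))
  let T : ℤ → EuclideanSpace ℝ (Fin 3) → ℂ := fun k ζ =>
    c k * Complex.exp (2 * Real.pi * Complex.I * k * (a * ζ 2 : ℝ)) * (fourierCharacter ζ q * G ζ)
  have hTn : ∀ k ζ, ‖T k ζ‖ ≤ ‖c k‖ * ‖G ζ‖ := by
    intro k ζ
    simp only [T]
    rw [norm_mul, norm_mul (fourierCharacter ζ q), norm_fourierCharacter, one_mul]
    gcongr
    exact hn k _
  have hTi : ∀ k, Integrable (T k) := fun k => by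
    refine Integrable.mono' (G.integrable.norm.const_mul ‖c k‖) ?_
      (Filter.Eventually.of_forall (hTn k))
    have := G.continuous
    exact Continuous.aestronglyMeasurable (by fun_prop)
  have hTs : Summable fun k => ∫ ζ, ‖T k ζ‖ := by
    refine Summable.of_nonneg_of_le (fun k => integral_nonneg fun _ => norm_nonneg _) (fun k => ?_)
      (hcs.mul_right (∫ ζ, ‖G ζ‖))
    rw [← integral_const_mul]
    exact integral_mono (hTi k).norm (G.integrable.norm.const_mul _) (hTn k)
  have hsum := hasSum_integral_of_summable_integral_norm hTi hTs
  have hTk : ∀ k, ∫ ζ, T k ζ = c k * f (q + (0, 0, k * a)) := by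
    intro k
    rw [hG, ← integral_const_mul]
    refine integral_congr_ae (Filter.Eventually.of_forall fun ζ => ?_)
    dsimp only [T]
    rw [fourierCharacter_translate]
    ring
  simp only [hTk] at hsum
  have h₀ := hsum.tsum_eq
  rw [tsum_eq_single 0 fun k hk => by
    rw [image_eq_zero_of_notMem_tsupport fun h => hU q hq k hk (hfU h), mul_zero]] at h₀
  have hq₀ : q + (0, 0, ((0 : ℤ) : ℝ) * a) = q := by
    ext <;> simp
  rw [hq₀] at h₀
  rw [h₀]
  refine integral_congr_ae (Filter.Eventually.of_forall fun ζ => ?_)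
  dsimp only [T]
  rw [tsum_mul_right]
  ring

theorem norm_apply_le_norm (ζ : EuclideanSpace ℝ (Fin 3)) (i : Fin 3) : |ζ i| ≤ ‖ζ‖ :=
  PiLp.norm_apply_le ζ i

/-- The estimate dual to the solvability of `P(X, Y) u = f` on `U`. The period `1 / γ₀²` is small
enough for the frequencies that survive in `exists_const_mul_eq_integral` to exceed `γ₀²`. -/
theorem exists_bound_integral_mul {n : ℕ} {P : ℕ → NCPoly}
    (hP : ∀ l ≤ n, (P l).IsHomogeneous l) {γ₀ : ℝ} (hγ₀ : 0 < γ₀)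
    (hplus : HasRegularParametrix (realization n P 1) γ₀)
    (hminus : HasRegularParametrix (realization n P (-1)) γ₀) {R : ℝ} (hR : 0 ≤ R)
    {U : Set H1} (hUR : U ⊆ {q : H1 | |q.1| ≤ R})
    (hU : ∀ q ∈ U, ∀ k : ℤ, k ≠ 0 → q + (0, 0, k * (γ₀ ^ 2)⁻¹) ∉ U)
    {f : H1 → ℂ} (hf : ContDiff ℝ ∞ f) (hc : HasCompactSupport f) (hfU : tsupport f ⊆ U) :
    ∃ C : ℝ, 0 ≤ C ∧ ∀ φ : SmoothH1, HasCompactSupport φ.1 → tsupport φ.1 ⊆ U →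
      ‖∫ q, f q * φ.1 q‖ ≤
        C * ∫ q, ‖(formalTranspose (∑ l ∈ Finset.range (n + 1), P l) φ).1 q‖ := by
  set Q := ∑ l ∈ Finset.range (n + 1), P l
  obtain ⟨C, M, hC, hCM⟩ := exists_bound_character hP hγ₀ hplus hminus hR
  obtain ⟨c, G, m, B, hc₀, hm, hmB, hm₀, hint⟩ := exists_const_mul_eq_integral hf hc hfU hU
  have hB : 0 ≤ B := (norm_nonneg _).trans (hmB 0)
  set D := ∫ ζ, (6 * Real.pi * ‖ζ‖ + 1) ^ M * ‖G ζ‖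
  have hD : 0 ≤ D := integral_nonneg fun ζ => by positivity
  refine ⟨‖c‖⁻¹ * (B * C * D), by positivity, fun φ hφ hφU => ?_⟩
  set I := ∫ q, ‖(formalTranspose Q φ).1 q‖
  have hI : 0 ≤ I := integral_nonneg fun _ => norm_nonneg _
  have hφi : Integrable φ.1 := (smoothH1_continuous φ).integrable_of_hasCompactSupport hφ
  have hprod : Integrable (fun z : H1 × EuclideanSpace ℝ (Fin 3) =>
      fourierCharacter z.2 z.1 * (m ((γ₀ ^ 2)⁻¹ * z.2 2) * (φ.1 z.1 * G z.2)))
      (volume.prod volume) := by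
    refine Integrable.mono' ((hφi.mul_prod G.integrable).norm.const_mul B) ?_
      (Filter.Eventually.of_forall fun z => ?_)
    · have h₁ := G.continuous
      have h₂ := smoothH1_continuous φ
      have h₃ := continuous_fourierCharacter
      exact Continuous.aestronglyMeasurable (by fun_prop)
    · rw [norm_mul, norm_fourierCharacter, one_mul, norm_mul]
      gcongr
      exact hmB _
  have key : c * ∫ q, f q * φ.1 q =
      ∫ ζ, m ((γ₀ ^ 2)⁻¹ * ζ 2) * G ζ * ∫ q, fourierCharacter ζ q * φ.1 q := by
    calc c * ∫ q, f q * φ.1 q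
        = ∫ q, ∫ ζ, fourierCharacter ζ q * (m ((γ₀ ^ 2)⁻¹ * ζ 2) * (φ.1 q * G ζ)) := by
          rw [← integral_const_mul]
          refine integral_congr_ae (Filter.Eventually.of_forall fun q => ?_)
          dsimp only
          by_cases hq : q ∈ tsupport φ.1
          · rw [← mul_assoc, hint q (hφU hq), ← integral_mul_const]
            refine integral_congr_ae (Filter.Eventually.of_forall fun ζ => ?_)
            dsimp only
            ring
          · simp [image_eq_zero_of_notMem_tsupport hq]
      _ = ∫ ζ, ∫ q, fourierCharacter ζ q * (m ((γ₀ ^ 2)⁻¹ * ζ 2) * (φ.1 q * G ζ)) :=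
          integral_integral_swap hprod
      _ = _ := by
          refine integral_congr_ae (Filter.Eventually.of_forall fun ζ => ?_)
          dsimp only
          rw [← integral_const_mul]
          refine integral_congr_ae (Filter.Eventually.of_forall fun q => ?_)
          dsimp only
          ring
  have hbound : ‖c * ∫ q, f q * φ.1 q‖ ≤ B * C * I * D := by
    rw [key, ← integral_const_mul]
    refine norm_integral_le_of_norm_le ((integrable_pow_mul_norm G _ M).const_mul _)
      (Filter.Eventually.of_forall fun ζ => ?_)
    rcases le_or_gt |(γ₀ ^ 2)⁻¹ * ζ 2| (1 / 4) with hs | hs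
    · rw [hm₀ _ hs, zero_mul, zero_mul, norm_zero]
      positivity
    · -- The frequency in `w` is `2π ζ 2`, and `2π / 4 > 1`.
      have hμ : γ₀ ^ 2 < |2 * Real.pi * ζ 2| := by
        have hγ : 0 < γ₀ ^ 2 := by positivity
        rw [abs_mul, abs_of_pos (inv_pos.2 hγ), ← div_eq_inv_mul, lt_div_iff₀ hγ] at hs
        rw [abs_mul, abs_of_pos Real.two_pi_pos]
        nlinarith [Real.pi_gt_three, abs_nonneg (ζ 2)]
      have h₁ := hCM (2 * Real.pi * ζ 0) (2 * Real.pi * ζ 1) _ hμ φ hφ (hφU.trans hUR)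
      have h₂ : ∀ i, |2 * Real.pi * ζ i| ≤ 2 * Real.pi * ‖ζ‖ := fun i => by
        rw [abs_mul, abs_of_pos Real.two_pi_pos]
        exact mul_le_mul_of_nonneg_left (norm_apply_le_norm ζ i) Real.two_pi_pos.le
      have h₃ : 1 + |2 * Real.pi * ζ 0| + |2 * Real.pi * ζ 1| + |2 * Real.pi * ζ 2| ≤
          6 * Real.pi * ‖ζ‖ + 1 := by linarith [h₂ 0, h₂ 1, h₂ 2]
      rw [norm_mul, norm_mul]
      calc _ ≤ B * ‖G ζ‖ * (C * (6 * Real.pi * ‖ζ‖ + 1) ^ M * I) := by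
            refine mul_le_mul (mul_le_mul_of_nonneg_right (hmB _) (norm_nonneg _))
              (h₁.trans ?_) (norm_nonneg _) (by positivity)
            gcongr
        _ = _ := by ring
  rw [norm_mul] at hbound
  rw [mul_assoc, le_inv_mul_iff₀ (norm_pos_iff.2 hc₀)]
  linarith

/-! ### Duality -/

/-- Hahn–Banach: a functional `ℓ` dominated by `p ∘ A` factors through `A` as a functional
dominated by `p`. -/
theorem exists_dual_comp_eq_of_le_seminorm {V E : Type*} [AddCommGroup V] [Module ℂ V]
    [AddCommGroup E] [Module ℂ E] (A : V →ₗ[ℂ] E) (l : V →ₗ[ℂ] ℂ) (p : Seminorm ℂ E)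
    (h : ∀ v, ‖l v‖ ≤ p (A v)) :
    ∃ T : E →ₗ[ℂ] ℂ, (∀ v, T (A v) = l v) ∧ ∀ x, ‖T x‖ ≤ p x := by
  have hker : LinearMap.ker A ≤ LinearMap.ker l := fun v hv => by
    rw [LinearMap.mem_ker] at hv ⊢
    have := h v
    rw [hv, map_zero] at this
    exact norm_le_zero_iff.1 this
  let l₀ : LinearMap.range A →ₗ[ℂ] ℂ :=
    (LinearMap.ker A).liftQ l hker ∘ₗ A.quotKerEquivRange.symm.toLinearMap
  have hl₀ : ∀ v, l₀ ⟨A v, LinearMap.mem_range_self A v⟩ = l v := fun v => by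
    have : A.quotKerEquivRange.symm ⟨A v, LinearMap.mem_range_self A v⟩ =
        (LinearMap.ker A).mkQ v := by
      rw [LinearEquiv.symm_apply_eq]
      rfl
    simp [l₀, this]
  obtain ⟨T, hT, hTp⟩ := Module.Dual.exists_extension_of_le_seminorm (LinearMap.range A) l₀
    (p := p) (by
      rintro ⟨_, v, rfl⟩
      rw [hl₀]
      exact h v)
  exact ⟨T, fun v => (hT ⟨A v, LinearMap.mem_range_self A v⟩).trans (hl₀ v), hTp⟩

theorem integrableOn_ball (φ : SmoothH1) (p : H1) (r : ℝ) :
    IntegrableOn φ.1 (Metric.ball p r) :=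
  ((smoothH1_continuous φ).continuousOn.integrableOn_compact
    (isCompact_closedBall p r)).mono_set Metric.ball_subset_closedBall

/-- The `L¹` seminorm on a ball, on smooth functions. -/
def ballSeminorm (p : H1) (r : ℝ) : Seminorm ℂ SmoothH1 :=
  Seminorm.of (fun φ => ∫ q in Metric.ball p r, ‖φ.1 q‖)
    (fun φ ψ => by
      rw [← integral_add (integrableOn_ball φ p r).norm (integrableOn_ball ψ p r).norm]
      exact integral_mono (integrableOn_ball (φ + ψ) p r).norm
        ((integrableOn_ball φ p r).norm.add (integrableOn_ball ψ p r).norm)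
        fun q => norm_add_le _ _)
    (fun c φ => by
      rw [← integral_const_mul]
      simp)

theorem ballSeminorm_eq_integral {p : H1} {r : ℝ} {φ : SmoothH1}
    (hφ : tsupport φ.1 ⊆ Metric.ball p r) : ballSeminorm p r φ = ∫ q, ‖φ.1 q‖ :=
  setIntegral_eq_integral_of_forall_compl_eq_zero fun q hq => by
    rw [image_eq_zero_of_notMem_tsupport fun h => hq (hφ h), norm_zero]

/-- The smooth functions with compact support in a given set. -/
def compactlySupportedIn (U : Set H1) : Submodule ℂ SmoothH1 where
  carrier := {φ | HasCompactSupport φ.1 ∧ tsupport φ.1 ⊆ U}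
  add_mem' hφ hψ := ⟨hφ.1.add hψ.1, (tsupport_add _ _).trans (Set.union_subset hφ.2 hψ.2)⟩
  zero_mem' := ⟨HasCompactSupport.zero, by
    change tsupport (0 : H1 → ℂ) ⊆ U
    simp⟩
  smul_mem' c φ hφ := ⟨HasCompactSupport.smul_left (f := fun _ => c) hφ.1,
    (tsupport_smul_subset_right (fun _ => c) φ.1).trans hφ.2⟩

/-- Integration against a fixed smooth function, as a functional on compactly supported ones. -/
def integralPairing (f : SmoothH1) (U : Set H1) : compactlySupportedIn U →ₗ[ℂ] ℂ where
  toFun φ := ∫ q, f.1 q * φ.1.1 q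
  map_add' φ ψ := by
    rw [← integral_add (smoothH1_integrable_mul f φ.1 φ.2.1)
      (smoothH1_integrable_mul f ψ.1 ψ.2.1)]
    simp [mul_add]
  map_smul' c φ := by
    rw [RingHom.id_apply, smul_eq_mul, ← integral_const_mul]
    simp [mul_left_comm]

open TopologicalSpace in
/-- A functional that is bounded by the `L¹` norm on a ball restricts to a distribution there. -/
theorem exists_distribution_eq {p : H1} {r : ℝ} {U : Opens H1}
    (T : SmoothH1 →ₗ[ℂ] ℂ) {C : ℝ} (hC : 0 ≤ C)
    (hT : ∀ φ, ‖T φ‖ ≤ C * ballSeminorm p r φ) :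
    ∃ u : 𝓓'(U, ℂ), ∀ ψ : 𝓓(U, ℝ), u ψ = T (testToSmooth ψ) := by
  let Φ : 𝓓(U, ℝ) →ₗ[ℝ] ℂ :=
    { toFun := fun ψ => T (testToSmooth ψ)
      map_add' := fun ψ χ => by
        rw [← map_add]
        congr 1
        ext q
        simp [testToSmooth]
      map_smul' := fun c ψ => by
        have : testToSmooth (c • ψ) = (c : ℂ) • testToSmooth ψ := by
          ext q
          simp [testToSmooth]
        rw [this, map_smul]
        simp }
  set v := (volume : Measure H1).real (Metric.ball p r)
  have hΦ : ∀ ψ, ‖Φ ψ‖ ≤ C * v * ‖TestFunction.toBoundedContinuousFunctionCLM ℝ ψ‖ := fun ψ => by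
    refine (hT (testToSmooth ψ)).trans ?_
    rw [mul_assoc]
    refine mul_le_mul_of_nonneg_left ?_ hC
    have : ballSeminorm p r (testToSmooth ψ) ≤
        ∫ _ in Metric.ball p r, ‖TestFunction.toBoundedContinuousFunctionCLM ℝ ψ‖ := by
      refine integral_mono (integrableOn_ball _ p r).norm
        (integrableOn_const measure_ball_lt_top.ne) fun q => ?_
      have h := (TestFunction.toBoundedContinuousFunctionCLM ℝ ψ).norm_coe_le_norm q
      simpa [testToSmooth] using h
    simpa [v] using this
  have hcont : Continuous Φ := by
    refine continuous_of_continuousAt_zero Φ ?_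
    rw [ContinuousAt, map_zero]
    refine squeeze_zero_norm hΦ ?_
    have h : Continuous fun ψ : 𝓓(U, ℝ) =>
        C * v * ‖TestFunction.toBoundedContinuousFunctionCLM ℝ ψ‖ :=
      continuous_const.mul (TestFunction.toBoundedContinuousFunctionCLM ℝ).continuous.norm
    have h₀ := h.tendsto 0
    rwa [map_zero, norm_zero, mul_zero] at h₀
  exact ⟨({ toLinearMap := Φ, cont := hcont } : 𝓓(U, ℝ) →L[ℝ] ℂ), fun _ => rfl⟩

theorem notMem_ball_add_central {p q : H1} {a : ℝ} (ha : 0 < a) (hq : q ∈ Metric.ball p (a / 2))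
    {k : ℤ} (hk : k ≠ 0) : q + (0, 0, k * a) ∉ Metric.ball p (a / 2) := by
  intro hq'
  have h₁ : dist (q + (0, 0, k * a)) q < a := by
    have := dist_triangle_right (q + (0, 0, k * a)) q p
    rw [Metric.mem_ball] at hq hq'
    linarith
  have h₂ : |k * a| ≤ dist (q + (0, 0, k * a)) q := by
    rw [dist_self_add_left]
    exact ((norm_snd_le _).trans (norm_snd_le ((0, 0, k * a) : H1)))
  have h₃ : (1 : ℝ) ≤ |(k : ℝ)| := by exact_mod_cast Int.one_le_abs hk
  rw [abs_mul, abs_of_pos ha] at h₂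
  nlinarith

end HeisenbergSolvability

end

open HeisenbergSolvability
theorem lemma1 (n : ℕ) (hn : 2 ≤ n) (P : ℕ → NCPoly)
    (hP : ∀ l ≤ n, (P l).IsHomogeneous l) (hgen : (P n).IsGeneric n)
    (γ₀ : ℝ) (hγ₀ : 0 < γ₀)
    (hplus : HasRegularParametrix (realization n P 1) γ₀)
    (hminus : HasRegularParametrix (realization n P (-1)) γ₀) :
    LocallySolvable (∑ l ∈ Finset.range (n + 1), P l) := by
  intro p
  have ha : 0 < (γ₀ ^ 2)⁻¹ := by positivity
  -- A ball of this radius is disjoint from its translates by the multiples of `1 / γ₀²` in `w`.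
  set r := (γ₀ ^ 2)⁻¹ / 2
  have hr₀ : 0 < r := by positivity
  let U : TopologicalSpace.Opens H1 := ⟨Metric.ball p r, Metric.isOpen_ball⟩
  refine ⟨U, Metric.mem_ball_self hr₀, fun f => ?_⟩
  have hUR : Metric.ball p r ⊆ {q : H1 | |q.1| ≤ |p.1| + r} := fun q hq => by
    have h₁ : |q.1 - p.1| ≤ dist q p := le_max_left _ _
    have h₂ : |q.1| ≤ |p.1| + |q.1 - p.1| := by
      simpa using abs_add_le p.1 (q.1 - p.1)
    have h₃ : dist q p < r := hq
    change |q.1| ≤ _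
    linarith
  obtain ⟨C, hC, hest⟩ := exists_bound_integral_mul hP hγ₀ hplus hminus
    (add_nonneg (abs_nonneg p.1) hr₀.le) hUR
    (fun q hq k hk => notMem_ball_add_central ha hq hk) f.contDiff f.hasCompactSupport
    f.tsupport_subset
  let F : SmoothH1 := ⟨f, f.contDiff⟩
  -- By the estimate, `ᵗP(X, Y) φ ↦ ∫ f φ` is well defined and bounded for the `L¹` norm.
  obtain ⟨T, hTf, hTC⟩ := exists_dual_comp_eq_of_le_seminorm
    (V := compactlySupportedIn (Metric.ball p r)) (E := SmoothH1)
    (formalTranspose (∑ l ∈ Finset.range (n + 1), P l) ∘ₗ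
      (compactlySupportedIn (Metric.ball p r)).subtype)
    (integralPairing F (Metric.ball p r)) (C.toNNReal • ballSeminorm p r) fun φ => by
      have hs := ((isTranspose_formalTranspose (∑ l ∈ Finset.range (n + 1), P l))
        φ.1 φ.2.1).1.trans φ.2.2
      have h := hest φ.1 φ.2.1 φ.2.2
      rw [← ballSeminorm_eq_integral hs] at h
      change ‖∫ q, f q * φ.1.1 q‖ ≤ _
      simpa [NNReal.smul_def, Real.coe_toNNReal C hC] using h
  obtain ⟨u, hu⟩ := exists_distribution_eq (p := p) (r := r) (U := U) T hC fun φ => by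
    simpa [NNReal.smul_def, Real.coe_toNNReal C hC] using hTC φ
  refine ⟨u, fun φ => ?_⟩
  have hφ : testToSmooth φ ∈ compactlySupportedIn (Metric.ball p r) :=
    ⟨φ.hasCompactSupport.comp_left (g := fun s : ℝ => (s : ℂ)) Complex.ofReal_zero,
      (tsupport_comp_subset (g := fun s : ℝ => (s : ℂ)) Complex.ofReal_zero φ).trans
        φ.tsupport_subset⟩
  rw [eval_opX_opY_apply_eq _ hu]
  refine (hTf ⟨testToSmooth φ, hφ⟩).trans ?_
  refine MeasureTheory.integral_congr_ae (Filter.Eventually.of_forall fun q => ?_)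
  change f q * (φ q : ℂ) = φ q • f q
  rw [Complex.real_smul, mul_comm]
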